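/- Let $n$ be an integer of the form $2$, $4$, $p^m$ or $2p^m$ with $p$ an odd prime and $m\ge 1$, put $d=\varphi(n)$, and let $\zeta$ be a primitive $n$-th root of unity. Let $\otimes$ be the multiplication on $\mathbb Z^d$ obtained from that of $\mathbb Z[\zeta]=\mathbb Z\oplus\mathbb Z\zeta\oplus\dots\oplus\mathbb Z\zeta^{d-1}$ through the isomorphism $\psi:\mathbb Z^d\to\mathbb Z[\zeta]$, $\psi(x)=\sum_{i<d}x_i\zeta^i$, i.e. $\psi(r\otimes u)=\psi(r)\psi(u)$; denote by the same symbol its $\mathbb R$-bilinear extension to $\mathbb R^d$. For a finite set $U\subset\mathbb Z^d$, a $U$-pattern in $\mathbb Z^d$ (resp. $\mathbb R^d$) with basepoint $x$ is a set $\{x+r\otimes u: u\in U\}$ with $x,r\in\mathbb Z^d$ (resp. $\mathbb R^d$) and $r\neq 0$. Write $[N]=\{1,\dots,N\}$, and let $\dim_M$ be the Minkowski (upper box) dimension. Consider sequences $(U_k)_{k\in\mathbb N}$ of sets $U_k\subset\mathbb Z^d$ with $|U_k|=k$, such that no $u\in U_k$ has a coordinate equal to $0$ and $\max_{u\in U_k}\|u\|_\infty\le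 2^{o(k)}$ as $k\to\infty$. (1) There is an absolute constant $c>0$ such that for every such $n$ and every such sequence $(U_k)$, for all sufficiently large $k$ (depending on $n$ and the sequence) and all sufficiently large $N$ (depending on $n$, the sequence and $k$), there is a finite set $B\subset\mathbb Z^d$ which contains a $U_k$-pattern with basepoint $x$ for every $x\in[N]^d$ and satisfies $$|B|<N^{\,d-c/\log k}.$$ (2) There is an absolute constant $c>0$ such that for every such $n$ and every such sequence $(U_k)$, for all sufficiently large $k$, there is a compact set $F\subset\mathbb R^d$ which contains a $U_k$-pattern with basepoint $x$ for every $x\in[0,1]^d$ and satisfies $$\dim_M F=d-\frac{c}{\log k}.$$ (3) Let $G'_k(N)$ be the size of the smallest set of integers that contains, for $N$ distinct integers $x$, an arithmetic progression $x+r,x+2r,\dots,x+kr$ with some integer $r\ne0$. There is an absolute constant $c>0$ such that for every $k\ge2$ and all sufficiently large $N$ (depending on $k$), $$G'_k(N)\le N^{1-c/\log k}.$$ -/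

import Mathlib

open Filter Topology Asymptotics Polynomial

/-- The polynomial `x₀ + x₁ X + ⋯ + x_{d-1} X^{d-1}` with coefficient vector `x`. -/
noncomputable def coordPoly {R : Type*} [CommRing R] {d : ℕ} (x : Fin d → R) : R[X] :=
  ∑ i, C (x i) * X ^ (i : ℕ)

/-- The multiplication `r ⊗ u` on `R ^ φ(n)`: multiply `r` and `u` as elements of
`R[ζ] = R[X] / (Φ_n)` in the basis `1, ζ, …, ζ^{φ(n)-1}` and read off the coordinates in that basis.
For `R = ℤ` this is multiplication in `ℤ[ζ_n] ≅ ℤ ^ φ(n)` (see `zetaCoord_cycloMul`,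
`zetaCoord_injective`, `range_zetaCoord`); for `R = ℝ` it is its `ℝ`-bilinear extension. -/
noncomputable def cycloMul (n : ℕ) {R : Type*} [CommRing R] (r u : Fin n.totient → R) :
    Fin n.totient → R :=
  fun l => ((coordPoly r * coordPoly u) %ₘ cyclotomic n R).coeff (l : ℕ)

/-- The natural map `ψ : (x₀, …, x_{d-1}) ↦ x₀ + x₁ ζ + ⋯ + x_{d-1} ζ^{d-1}`. -/
def zetaCoord {R A : Type*} [CommRing R] [CommRing A] [Algebra R A] {d : ℕ} (ζ : A)
    (x : Fin d → R) : A :=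
  ∑ i, algebraMap R A (x i) * ζ ^ (i : ℕ)

/-- The set `B ⊆ R ^ φ(n)` contains a `U`-pattern `x + r ⊗ U` with basepoint `x`, for some nonzero
scaling factor `r ∈ R ^ φ(n)` (used for `R = ℤ` and `R = ℝ`). -/
def ContainsPattern (n : ℕ) {R : Type*} [CommRing R] (U : Finset (Fin n.totient → ℤ))
    (B : Set (Fin n.totient → R)) (x : Fin n.totient → R) : Prop :=
  ∃ r : Fin n.totient → R, r ≠ 0 ∧ ∀ u ∈ U, x + cycloMul n r (fun i => (u i : R)) ∈ B

/-- The smallest positive number of axis-parallel closed cubes of side length `ε` that cover `E`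
(for bounded `E`). -/
noncomputable def boxCount {d : ℕ} (E : Set (Fin d → ℝ)) (ε : ℝ) : ℕ :=
  sInf {m : ℕ | 0 < m ∧ ∃ a : Fin m → (Fin d → ℝ),
    E ⊆ ⋃ j, Set.Icc (a j) (fun i => a j i + ε)}

/-- The Minkowski (upper box) dimension of a bounded set `E ⊆ ℝ^d`. -/
noncomputable def minkowskiDim {d : ℕ} (E : Set (Fin d → ℝ)) : EReal :=
  limsup (fun ε : ℝ => ((Real.log (boxCount E ε) / Real.log (1 / ε) : ℝ) : EReal)) (𝓝[>] 0)

/-- The set `B` of integers contains a `k`-term arithmetic progression `x + r, …, x + k r` with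
basepoint `x` and nonzero common difference `r`. -/
def ContainsAP (k : ℕ) (B : Set ℤ) (x : ℤ) : Prop :=
  ∃ r : ℤ, r ≠ 0 ∧ ∀ i ∈ Finset.Icc 1 k, x + (i : ℤ) * r ∈ B

/-- `G'_k(N)`: the size of the smallest set of integers that contains a `k`-term arithmetic
progression with basepoint `x` for `N` distinct integers `x`. -/
noncomputable def gPrime (k N : ℕ) : ℕ :=
  sInf {m : ℕ | ∃ B S : Finset ℤ, B.card = m ∧ S.card = N ∧ ∀ x ∈ S, ContainsAP k (B : Set ℤ) x}

/-- The minimum in the definition of `gPrime` is attained. -/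
theorem gPrime_spec (k N : ℕ) : ∃ B S : Finset ℤ, B.card = gPrime k N ∧ S.card = N ∧
    ∀ x ∈ S, ContainsAP k (B : Set ℤ) x := by
  refine Nat.sInf_mem (s := {m : ℕ | ∃ B S : Finset ℤ, B.card = m ∧ S.card = N ∧
    ∀ x ∈ S, ContainsAP k (B : Set ℤ) x}) ?_
  refine ⟨_, Finset.Icc (1 : ℤ) (N + k), Finset.Icc (1 : ℤ) N, rfl, by simp, ?_⟩
  intro x hx
  refine ⟨1, one_ne_zero, fun i hi => ?_⟩
  simp only [Finset.mem_Icc, Finset.coe_Icc, Set.mem_Icc] at *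
  omega

theorem coordPoly_degree_lt {R : Type*} [CommRing R] {d : ℕ} (x : Fin d → R) :
    (coordPoly x).degree < d :=
  lt_of_le_of_lt (degree_sum_le _ _) ((Finset.sup_lt_iff (WithBot.bot_lt_coe d)).2 fun i _ =>
    lt_of_le_of_lt (degree_C_mul_X_pow_le _ _) (WithBot.coe_lt_coe.2 i.2))

theorem coordPoly_coeff {R : Type*} [CommRing R] {d : ℕ} (x : Fin d → R) (l : Fin d) :
    (coordPoly x).coeff (l : ℕ) = x l := by
  simp [coordPoly, coeff_C_mul, coeff_X_pow, Fin.val_inj]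

theorem coordPoly_of_degree_lt {R : Type*} [CommRing R] {d : ℕ} (p : R[X]) (hp : p.degree < d) :
    coordPoly (fun l : Fin d => p.coeff (l : ℕ)) = p := by
  ext m
  by_cases hm : m < d
  · exact coordPoly_coeff (fun l : Fin d => p.coeff (l : ℕ)) ⟨m, hm⟩
  · have hdm : (d : WithBot ℕ) ≤ m := by exact_mod_cast not_lt.1 hm
    rw [coeff_eq_zero_of_degree_lt ((coordPoly_degree_lt _).trans_le hdm),
      coeff_eq_zero_of_degree_lt (hp.trans_le hdm)]

theorem aeval_coordPoly {R A : Type*} [CommRing R] [CommRing A] [Algebra R A] {d : ℕ} (ζ : A)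
    (x : Fin d → R) : aeval ζ (coordPoly x) = zetaCoord ζ x := by
  simp [coordPoly, zetaCoord]

/-- `ψ(r ⊗ u) = ψ(r) ψ(u)`. -/
theorem zetaCoord_cycloMul (n : ℕ) {R A : Type*} [CommRing R] [Nontrivial R] [CommRing A]
    [Algebra R A] (ζ : A) (hζ : aeval ζ (cyclotomic n R) = 0) (r u : Fin n.totient → R) :
    zetaCoord ζ (cycloMul n r u) = zetaCoord ζ r * zetaCoord ζ u := by
  have hm := cyclotomic.monic n R
  have hd := degree_modByMonic_lt (coordPoly r * coordPoly u) hm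
  rw [degree_cyclotomic] at hd
  have he : coordPoly (cycloMul n r u) = (coordPoly r * coordPoly u) %ₘ cyclotomic n R :=
    coordPoly_of_degree_lt _ hd
  rw [← aeval_coordPoly, he,
    aeval_modByMonic_eq_self_of_root hζ, map_mul, aeval_coordPoly, aeval_coordPoly]

/-- `ψ : ℤ ^ φ(n) → ℤ[ζ]` is injective for a primitive `n`-th root of unity `ζ`. -/
theorem zetaCoord_injective {n : ℕ} (hn : 0 < n) {ζ : ℂ} (hζ : IsPrimitiveRoot ζ n) :
    Function.Injective (zetaCoord ζ : (Fin n.totient → ℤ) → ℂ) := by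
  intro x y hxy
  rw [← aeval_coordPoly, ← aeval_coordPoly] at hxy
  have h0 : aeval ζ (coordPoly x - coordPoly y) = 0 := by rw [map_sub, hxy, sub_self]
  have hdvd : cyclotomic n ℤ ∣ coordPoly x - coordPoly y := by
    rw [cyclotomic_eq_minpoly hζ hn]
    exact minpoly.isIntegrallyClosed_dvd (hζ.isIntegral hn) h0
  have hlt : (coordPoly x - coordPoly y).degree < (cyclotomic n ℤ).degree := by
    rw [degree_cyclotomic]
    exact lt_of_le_of_lt (degree_sub_le _ _)
      (max_lt (coordPoly_degree_lt x) (coordPoly_degree_lt y))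
  have hz := Polynomial.eq_zero_of_dvd_of_degree_lt hdvd hlt
  funext l
  rw [← coordPoly_coeff x l, ← coordPoly_coeff y l, sub_eq_zero.1 hz]

/-- The image of `ψ : ℤ ^ φ(n) → ℂ` is the ring `ℤ[ζ]`. -/
theorem range_zetaCoord {n : ℕ} (hn : 0 < n) {ζ : ℂ} (hζ : IsPrimitiveRoot ζ n) :
    Set.range (zetaCoord ζ : (Fin n.totient → ℤ) → ℂ) = Algebra.adjoin ℤ {ζ} := by
  have hroot : aeval ζ (cyclotomic n ℤ) = 0 := by
    rw [cyclotomic_eq_minpoly hζ hn]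
    exact minpoly.aeval ℤ ζ
  ext z
  rw [Algebra.adjoin_singleton_eq_range_aeval]
  constructor
  · rintro ⟨x, rfl⟩
    exact ⟨coordPoly x, aeval_coordPoly ζ x⟩
  · rintro ⟨p, rfl⟩
    have hd := degree_modByMonic_lt p (cyclotomic.monic n ℤ)
    rw [degree_cyclotomic] at hd
    refine ⟨fun l => (p %ₘ cyclotomic n ℤ).coeff (l : ℕ), ?_⟩
    rw [← aeval_coordPoly, coordPoly_of_degree_lt _ hd]
    exact aeval_modByMonic_eq_self_of_root hroot

/-!
Modulo a prime `q` not dividing the norm of `u`, the map `x ↦ x + u x²` is invariant under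
`x ↦ -x - u⁻¹`, so it takes only about half of all values. Choosing `r ≡ x ⊗ x` modulo `k` such
primes, the Chinese remainder theorem makes the points `x + r ⊗ u` occupy at most a `(2/3) ^ k`
proportion of the residues modulo the product `W = exp (O(k log k))` of the primes, that is, at
most `W ^ (d - c / log k)` of them. Applying this to every base-`W` digit of the basepoint carries
the bound to all scales, for integers as well as for reals. In the continuous setting the
dimension becomes exact after adding a union of grids of all dyadic scales which has the desired
dimension. The statement on progressions is the case `n = 2`, `U = {1, …, k}`.
-/

/-! ### The multiplication `⊗` -/

theorem coordPoly_add {R : Type*} [CommRing R] {d : ℕ} (x y : Fin d → R) :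
    coordPoly (x + y) = coordPoly x + coordPoly y := by
  simp only [coordPoly, Pi.add_apply, C_add, add_mul, Finset.sum_add_distrib]

theorem coordPoly_smul {R : Type*} [CommRing R] {d : ℕ} (a : R) (x : Fin d → R) :
    coordPoly (a • x) = a • coordPoly x := by
  simp only [coordPoly, Pi.smul_apply, smul_eq_C_mul, smul_eq_mul, C_mul, mul_assoc,
    Finset.mul_sum]

theorem coordPoly_map {R S : Type*} [CommRing R] [CommRing S] {d : ℕ} (f : R →+* S)
    (x : Fin d → R) : coordPoly (f ∘ x) = (coordPoly x).map f := by
  simp only [coordPoly, Polynomial.map_sum, Polynomial.map_mul, map_C, Polynomial.map_pow, map_X,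
    Function.comp_apply]

theorem cycloMul_comm (n : ℕ) {R : Type*} [CommRing R] (r u : Fin n.totient → R) :
    cycloMul n r u = cycloMul n u r := by
  funext l
  simp only [cycloMul, mul_comm (coordPoly r)]

theorem cycloMul_map (n : ℕ) {R S : Type*} [CommRing R] [CommRing S] (f : R →+* S)
    (r u : Fin n.totient → R) : cycloMul n (f ∘ r) (f ∘ u) = f ∘ cycloMul n r u := by
  funext l
  simp only [cycloMul, coordPoly_map, ← Polynomial.map_mul, ← map_cyclotomic n f,
    ← map_modByMonic f (cyclotomic.monic n R), coeff_map, Function.comp_apply]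

theorem cycloMul_intCast (n : ℕ) (R : Type*) [CommRing R] (r u : Fin n.totient → ℤ) :
    cycloMul n (fun i => (r i : R)) (fun i => (u i : R)) = fun i => ((cycloMul n r u i : ℤ) : R) :=
  cycloMul_map n (Int.castRingHom R) r u

/-- The multiplication `⊗` as a bilinear map. -/
noncomputable def cycloMulHom (n : ℕ) (R : Type*) [CommRing R] :
    (Fin n.totient → R) →ₗ[R] (Fin n.totient → R) →ₗ[R] (Fin n.totient → R) :=
  have add_left (r s u : Fin n.totient → R) :
      cycloMul n (r + s) u = cycloMul n r u + cycloMul n s u := by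
    funext l
    simp only [cycloMul, coordPoly_add, add_mul, add_modByMonic, coeff_add, Pi.add_apply]
  have smul_left (a : R) (r u : Fin n.totient → R) :
      cycloMul n (a • r) u = a • cycloMul n r u := by
    funext l
    simp only [cycloMul, coordPoly_smul, smul_mul_assoc, smul_modByMonic, coeff_smul, Pi.smul_apply]
  LinearMap.mk₂ R (cycloMul n) add_left smul_left
    (fun r u v => by rw [cycloMul_comm, add_left, cycloMul_comm n u, cycloMul_comm n v])
    (fun a r u => by rw [cycloMul_comm, smul_left, cycloMul_comm n u])

theorem cycloMulHom_apply (n : ℕ) {R : Type*} [CommRing R] (r u : Fin n.totient → R) :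
    cycloMulHom n R r u = cycloMul n r u := rfl

/-- A positive integer `C` with `‖r ⊗ u‖ ≤ C ‖r‖ ‖u‖` for the sup norm on `ℝ ^ φ(n)`. -/
noncomputable def cycloBound (n : ℕ) : ℕ :=
  ⌈‖(cycloMulHom n ℝ).toContinuousBilinearMap‖⌉₊ + 1

theorem cycloBound_pos (n : ℕ) : 0 < cycloBound n :=
  Nat.succ_pos _

theorem norm_cycloMul_le (n : ℕ) (r u : Fin n.totient → ℝ) :
    ‖cycloMul n r u‖ ≤ cycloBound n * ‖r‖ * ‖u‖ := by
  refine ((cycloMulHom n ℝ).toContinuousBilinearMap.le_opNorm₂ r u).trans ?_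
  gcongr
  exact (Nat.le_ceil _).trans (by exact_mod_cast Nat.le_succ _)

theorem abs_cycloMul_le (n : ℕ) {r u : Fin n.totient → ℤ} {a b : ℕ} (hr : ∀ i, |r i| ≤ a)
    (hu : ∀ i, |u i| ≤ b) (l : Fin n.totient) : |cycloMul n r u l| ≤ cycloBound n * a * b := by
  have norm_le {x : Fin n.totient → ℤ} {c : ℕ} (hx : ∀ i, |x i| ≤ c) :
      ‖fun i => (x i : ℝ)‖ ≤ c :=
    (pi_norm_le_iff_of_nonneg c.cast_nonneg).2 fun i => by
      rw [Real.norm_eq_abs]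
      exact_mod_cast hx i
  have := calc
    |((cycloMul n r u l : ℤ) : ℝ)| ≤ ‖cycloMul n (fun i => (r i : ℝ)) (fun i => (u i : ℝ))‖ := by
      rw [cycloMul_intCast]
      exact norm_le_pi_norm (fun i => ((cycloMul n r u i : ℤ) : ℝ)) l
    _ ≤ cycloBound n * ‖fun i => (r i : ℝ)‖ * ‖fun i => (u i : ℝ)‖ := norm_cycloMul_le n _ _
    _ ≤ cycloBound n * a * b := by gcongr <;> exact norm_le ‹_›
  exact_mod_cast this

/-- The identification of `R ^ φ(n)` with the ring `R[ζ] = R[X] / (Φ_n)` under which `⊗` becomes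
the multiplication. -/
noncomputable def cycloEquiv (n : ℕ) (R : Type*) [CommRing R] [Nontrivial R] :
    (Fin n.totient → R) ≃ₗ[R] AdjoinRoot (cyclotomic n R) :=
  ((AdjoinRoot.powerBasis' (cyclotomic.monic n R)).basis.reindex
    (finCongr (natDegree_cyclotomic n R))).equivFun.symm

theorem cycloEquiv_apply (n : ℕ) {R : Type*} [CommRing R] [Nontrivial R] (x : Fin n.totient → R) :
    cycloEquiv n R x = zetaCoord (AdjoinRoot.root (cyclotomic n R)) x := by
  rw [cycloEquiv, Module.Basis.equivFun_symm_apply]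
  refine Finset.sum_congr rfl fun i _ => ?_
  rw [Algebra.smul_def, Module.Basis.reindex_apply, PowerBasis.basis_eq_pow]
  rfl

theorem cycloEquiv_cycloMul (n : ℕ) {R : Type*} [CommRing R] [Nontrivial R]
    (r u : Fin n.totient → R) :
    cycloEquiv n R (cycloMul n r u) = cycloEquiv n R r * cycloEquiv n R u := by
  simp only [cycloEquiv_apply]
  refine zetaCoord_cycloMul n _ ?_ r u
  rw [AdjoinRoot.aeval_eq, AdjoinRoot.mk_self]

theorem cycloMul_ne_zero {n : ℕ} (hn : 0 < n) {r u : Fin n.totient → ℤ} (hr : r ≠ 0)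
    (hu : u ≠ 0) : cycloMul n r u ≠ 0 := by
  have := AdjoinRoot.isDomain_of_prime (cyclotomic.irreducible hn).prime
  rw [← map_ne_zero_iff _ (cycloEquiv n ℤ).injective, cycloEquiv_cycloMul]
  exact mul_ne_zero ((map_ne_zero_iff _ (cycloEquiv n ℤ).injective).2 hr)
    ((map_ne_zero_iff _ (cycloEquiv n ℤ).injective).2 hu)

/-- The norm of `u ∈ R[ζ]`, as the determinant of the multiplication by `u`. -/
noncomputable def cycloNorm (n : ℕ) {R : Type*} [CommRing R] (u : Fin n.totient → R) : R :=
  LinearMap.det (cycloMulHom n R u)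

theorem cycloNorm_ne_zero {n : ℕ} (hn : 0 < n) {u : Fin n.totient → ℤ} (hu : u ≠ 0) :
    cycloNorm n u ≠ 0 := by
  rw [cycloNorm, Ne, LinearMap.det_eq_zero_iff_ker_ne_bot, not_not, LinearMap.ker_eq_bot']
  intro r hr
  by_contra hr0
  exact cycloMul_ne_zero hn hu hr0 hr

theorem natAbs_cycloNorm_le (n : ℕ) {u : Fin n.totient → ℤ} {b : ℕ} (hu : ∀ i, |u i| ≤ b) :
    (cycloNorm n u).natAbs ≤ n.totient.factorial * (cycloBound n * b) ^ n.totient := by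
  have entry_le (l i : Fin n.totient) :
      AbsoluteValue.abs (LinearMap.toMatrix' (cycloMulHom n ℤ u) l i) ≤ (cycloBound n * b : ℤ) := by
    rw [LinearMap.toMatrix'_apply, cycloMulHom_apply, AbsoluteValue.abs_apply]
    have single_le (j : Fin n.totient) : |Pi.single (M := fun _ => ℤ) i 1 j| ≤ (1 : ℕ) := by
      rcases eq_or_ne j i with rfl | hji
      · simp
      · simp [hji]
    simpa using abs_cycloMul_le n hu single_le l
  have := Matrix.det_le entry_le
  rw [LinearMap.det_toMatrix', AbsoluteValue.abs_apply, Fintype.card_fin, nsmul_eq_mul] at this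
  zify
  exact this

theorem cycloNorm_map (n : ℕ) {R S : Type*} [CommRing R] [CommRing S] (f : R →+* S)
    (u : Fin n.totient → R) : cycloNorm n (f ∘ u) = f (cycloNorm n u) := by
  rw [cycloNorm, cycloNorm, ← LinearMap.det_toMatrix', ← LinearMap.det_toMatrix', RingHom.map_det]
  congr 1
  ext l i
  have single_eq : Pi.single i (1 : S) = f ∘ Pi.single i 1 := by
    funext j
    simp [Pi.single_apply, apply_ite f]
  rw [LinearMap.toMatrix'_apply, RingHom.mapMatrix_apply, Matrix.map_apply,
    LinearMap.toMatrix'_apply, cycloMulHom_apply, cycloMulHom_apply, single_eq, cycloMul_map,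
    Function.comp_apply]

theorem isUnit_cycloEquiv (n : ℕ) {R : Type*} [CommRing R] [Nontrivial R]
    {u : Fin n.totient → R} (hu : IsUnit (cycloNorm n u)) : IsUnit (cycloEquiv n R u) := by
  have surjective : Function.Surjective (cycloMulHom n R u) :=
    ((Module.End.isUnit_iff _).1 ((LinearMap.isUnit_iff_isUnit_det _).2 hu)).2
  obtain ⟨v, hv⟩ := surjective ((cycloEquiv n R).symm 1)
  refine IsUnit.of_mul_eq_one (cycloEquiv n R v) ?_
  rw [← cycloEquiv_cycloMul, ← cycloMulHom_apply, hv, LinearEquiv.apply_symm_apply]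

/-! ### Quadratic maps modulo primes -/

theorem two_mul_card_image_le {α β : Type*} [Fintype α] [DecidableEq α] [DecidableEq β]
    (f : α → β) (σ : α → α) (hf : ∀ x, f (σ x) = f x) :
    2 * (Finset.univ.image f).card ≤
      Fintype.card α + (Finset.univ.filter fun x => σ x = x).card := by
  have fiber_le (y : β) (hy : y ∈ Finset.univ.image f) :
      2 ≤ (Finset.univ.filter fun x => f x = y).card +
        ((Finset.univ.filter fun x => σ x = x).filter fun x => f x = y).card := by
    obtain ⟨x, -, rfl⟩ := Finset.mem_image.1 hy
    have mem_fiber : x ∈ Finset.univ.filter fun z => f z = f x := by simp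
    have map_mem_fiber : σ x ∈ Finset.univ.filter fun z => f z = f x := by simp [hf]
    by_cases hx : σ x = x
    · have fixed_mem : x ∈ (Finset.univ.filter fun z => σ z = z).filter fun z => f z = f x := by
        simp [hx]
      exact Nat.add_le_add (Finset.card_pos.2 ⟨x, mem_fiber⟩) (Finset.card_pos.2 ⟨x, fixed_mem⟩)
    · exact Nat.le_add_right_of_le
        (Finset.one_lt_card.2 ⟨σ x, map_mem_fiber, x, mem_fiber, hx⟩)
  have maps_to (s : Finset α) : Set.MapsTo f s (Finset.univ.image f) :=
    fun x _ => Finset.mem_coe.2 (Finset.mem_image_of_mem f (Finset.mem_univ x))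
  rw [← Finset.card_univ, Finset.card_eq_sum_card_fiberwise (maps_to Finset.univ),
    Finset.card_eq_sum_card_fiberwise (maps_to _), ← Finset.sum_add_distrib, mul_comm,
    ← smul_eq_mul]
  exact Finset.card_nsmul_le_sum _ _ _ fiber_le

theorem two_mul_card_image_quadratic_le {S : Type*} [CommRing S] [Fintype S] [DecidableEq S]
    (h2 : IsUnit (2 : S)) {u : S} (hu : IsUnit u) :
    2 * (Finset.univ.image fun x : S => x + x * x * u).card ≤ Fintype.card S + 1 := by
  obtain ⟨u, rfl⟩ := hu
  have fixed_unique : (Finset.univ.filter fun x : S => -x - ↑u⁻¹ = x).card ≤ 1 := by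
    refine Finset.card_le_one.2 fun x hx y hy => h2.mul_left_cancel ?_
    linear_combination (Finset.mem_filter.1 hy).2 - (Finset.mem_filter.1 hx).2
  have invariant (x : S) :
      (-x - ↑u⁻¹) + (-x - ↑u⁻¹) * (-x - ↑u⁻¹) * u = x + x * x * (u : S) := by
    linear_combination (2 * x + ↑u⁻¹) * u.inv_mul
  exact (two_mul_card_image_le (fun x : S => x + x * x * u) (fun x => -x - ↑u⁻¹) invariant).trans
    (Nat.add_le_add_left fixed_unique _)

/-- The values of `x + x ⊗ x ⊗ u` on `R ^ φ(n)`. -/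
noncomputable def quadValues (n : ℕ) {R : Type*} [CommRing R] [Fintype R] [DecidableEq R]
    (u : Fin n.totient → R) : Finset (Fin n.totient → R) :=
  Finset.univ.image fun x => x + cycloMul n (cycloMul n x x) u

theorem two_mul_card_quadValues_le (n : ℕ) {R : Type*} [CommRing R] [Nontrivial R] [Fintype R]
    [DecidableEq R] (h2 : IsUnit (2 : R)) {u : Fin n.totient → R} (hu : IsUnit (cycloNorm n u)) :
    2 * (quadValues n u).card ≤ Fintype.card R ^ n.totient + 1 := by
  classical
  let e := cycloEquiv n R
  let _ : Fintype (AdjoinRoot (cyclotomic n R)) := Fintype.ofEquiv _ e.toEquiv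
  have image_eq : (quadValues n u).image e =
      Finset.univ.image fun z : AdjoinRoot (cyclotomic n R) => z + z * z * e u := by
    rw [quadValues, Finset.image_image, ← Finset.image_univ_equiv e.toEquiv, Finset.image_image]
    refine Finset.image_congr fun x _ => ?_
    simp [e, cycloEquiv_cycloMul]
  have h2' : IsUnit (2 : AdjoinRoot (cyclotomic n R)) := by
    simpa only [map_ofNat] using h2.map (algebraMap R (AdjoinRoot (cyclotomic n R)))
  have := two_mul_card_image_quadratic_le h2' (isUnit_cycloEquiv n hu)
  rwa [← image_eq, Finset.card_image_of_injective _ e.injective, ← Fintype.card_congr e.toEquiv,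
    Fintype.card_fun, Fintype.card_fin] at this

theorem intCast_add_cycloMul_mem_quadValues (n : ℕ) {q : ℕ} [NeZero q]
    {x ρ u : Fin n.totient → ℤ} (hρ : ∀ i, (q : ℤ) ∣ ρ i - cycloMul n x x i) :
    (fun i => ((x + cycloMul n ρ u) i : ZMod q)) ∈ quadValues n fun i => (u i : ZMod q) := by
  have ρ_eq : (fun i => (ρ i : ZMod q)) = fun i => ((cycloMul n x x i : ℤ) : ZMod q) := by
    funext i
    exact ((ZMod.intCast_eq_intCast_iff_dvd_sub _ _ q).2 (hρ i)).symm
  refine Finset.mem_image.2 ⟨fun i => x i, Finset.mem_univ _, ?_⟩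
  rw [cycloMul_intCast, ← ρ_eq, cycloMul_intCast]
  funext i
  simp

theorem three_mul_card_quadValues_le {n : ℕ} (hn : 0 < n) {q : ℕ} [Fact q.Prime] (hq2 : q ≠ 2)
    {u : Fin n.totient → ℤ} (hu : ¬ (q : ℤ) ∣ cycloNorm n u) :
    3 * (quadValues n fun i => (u i : ZMod q)).card ≤ 2 * q ^ n.totient := by
  have hq := Fact.out (p := q.Prime)
  have h2 : IsUnit (2 : ZMod q) := by
    have : ((2 : ℕ) : ZMod q) ≠ 0 := by
      rwa [Ne, ZMod.natCast_eq_zero_iff, Nat.prime_dvd_prime_iff_eq hq Nat.prime_two]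
    exact this.isUnit
  have norm_unit : IsUnit (cycloNorm n fun i => (u i : ZMod q)) := by
    have := cycloNorm_map n (Int.castRingHom (ZMod q)) u
    rw [← ZMod.intCast_zmod_eq_zero_iff_dvd] at hu
    exact (this.trans_ne hu).isUnit
  have := two_mul_card_quadValues_le n h2 norm_unit
  rw [ZMod.card] at this
  have : 3 ≤ q ^ n.totient :=
    (hq.two_le.lt_of_ne' hq2).trans_le (Nat.le_self_pow (Nat.totient_pos.2 hn).ne' q)
  omega

open Function in
theorem card_le_of_residues {ι κ : Type*} [Fintype ι] [Fintype κ] {q : κ → ℕ}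
    (q_pos : ∀ j, 0 < q j) (coprime : Pairwise (Nat.Coprime on q))
    (V : ∀ j, Finset (ι → ZMod (q j))) (a b : ℤ) (Y : Finset (ι → ℤ))
    (residue_mem : ∀ y ∈ Y, ∀ j, (fun i => (y i : ZMod (q j))) ∈ V j)
    (mem_Ico : ∀ y ∈ Y, ∀ i, y i ∈ Set.Ico (a * ∏ j, (q j : ℤ)) (b * ∏ j, (q j : ℤ))) :
    Y.card ≤ (∏ j, (V j).card) * (b - a).toNat ^ Fintype.card ι := by
  classical
  set Q : ℤ := ∏ j, (q j : ℤ)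
  have Q_pos : 0 < Q := Finset.prod_pos fun j _ => by exact_mod_cast q_pos j
  let residuesAndQuotient (y : ι → ℤ) : (∀ j, ι → ZMod (q j)) × (ι → ℤ) :=
    (fun _ i => y i, fun i => y i / Q)
  let cells := Fintype.piFinset V ×ˢ Fintype.piFinset fun _ : ι => Finset.Ico a b
  have maps_to : Set.MapsTo residuesAndQuotient Y cells := by
    intro y hy
    simp only [cells, Finset.mem_coe, Finset.mem_product, Fintype.mem_piFinset, Finset.mem_Ico]
    exact ⟨residue_mem y hy, fun i => ⟨(Int.le_ediv_iff_mul_le Q_pos).2 (mem_Ico y hy i).1,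
      (Int.ediv_lt_iff_lt_mul Q_pos).2 (mem_Ico y hy i).2⟩⟩
  have injective : Function.Injective residuesAndQuotient := by
    intro y z hyz
    obtain ⟨residue_eq, quotient_eq⟩ := Prod.mk.inj hyz
    funext i
    have Q_dvd : Q ∣ y i - z i := by
      refine Finset.prod_dvd_of_coprime
        (fun j _ l _ hjl => Nat.isCoprime_iff_coprime.2 (coprime hjl)) fun j _ => ?_
      rw [← ZMod.intCast_zmod_eq_zero_iff_dvd, Int.cast_sub, sub_eq_zero]
      exact congrFun (congrFun residue_eq j) i
    rw [← Int.mul_ediv_add_emod (y i) Q, ← Int.mul_ediv_add_emod (z i) Q,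
      congrFun quotient_eq i,
      Int.emod_eq_emod_iff_emod_sub_eq_zero.2 (Int.emod_eq_zero_of_dvd Q_dvd)]
  refine (Finset.card_le_card_of_injOn _ maps_to injective.injOn).trans_eq ?_
  rw [Finset.card_product, Fintype.card_piFinset, Fintype.card_piFinset, Finset.prod_const,
    Int.card_Ico, Finset.card_univ]

/-- The points `x + r(x) ⊗ u` with `x ∈ {0, …, M-1} ^ φ(n)`. -/
noncomputable def patternPoints (n M : ℕ) (r : (Fin n.totient → ℤ) → (Fin n.totient → ℤ))
    (u : Fin n.totient → ℤ) : Finset (Fin n.totient → ℤ) :=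
  (Fintype.piFinset fun _ => Finset.Ico (0 : ℤ) M).image fun x => x + cycloMul n (r x) u

/-- The representative of `x ⊗ x` modulo `Q` with coordinates in `[Q, 2Q)`, hence nonzero. -/
noncomputable def quadScale (n Q : ℕ) (x : Fin n.totient → ℤ) : Fin n.totient → ℤ :=
  fun i => cycloMul n x x i % Q + Q

theorem quadScale_mem_Ico (n : ℕ) {Q : ℕ} (hQ : 0 < Q) (x : Fin n.totient → ℤ)
    (i : Fin n.totient) : quadScale n Q x i ∈ Set.Ico (Q : ℤ) (2 * Q) := by
  have := Int.emod_nonneg (cycloMul n x x i) (b := Q) (by omega)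
  have := Int.emod_lt_of_pos (cycloMul n x x i) (b := Q) (by omega)
  rw [quadScale, Set.mem_Ico]
  omega

theorem dvd_quadScale_sub (n Q : ℕ) (x : Fin n.totient → ℤ) (i : Fin n.totient) :
    (Q : ℤ) ∣ quadScale n Q x i - cycloMul n x x i := by
  refine ⟨1 - cycloMul n x x i / Q, ?_⟩
  rw [quadScale]
  linear_combination Int.mul_ediv_add_emod (cycloMul n x x i) Q

theorem mem_Ico_of_mem_patternPoints_quadScale {n Q b : ℕ} (hQ : 0 < Q) {u : Fin n.totient → ℤ}
    (hu : ∀ i, |u i| ≤ b) {y : Fin n.totient → ℤ}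
    (hy : y ∈ patternPoints n (2 * cycloBound n * b * Q) (quadScale n Q) u) (i : Fin n.totient) :
    y i ∈ Set.Ico (-(2 * cycloBound n * b) * (Q : ℤ)) (4 * cycloBound n * b * Q) := by
  obtain ⟨x, hx, rfl⟩ := Finset.mem_image.1 hy
  have x_mem := Finset.mem_Ico.1 (Fintype.mem_piFinset.1 hx i)
  have scale_le (j : Fin n.totient) : |quadScale n Q x j| ≤ (2 * Q : ℕ) := by
    have := quadScale_mem_Ico n hQ x j
    rw [abs_of_nonneg ((Int.natCast_nonneg Q).trans this.1)]
    exact_mod_cast this.2.le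
  have product_le := abs_le.1 (abs_cycloMul_le n scale_le hu i)
  push_cast at x_mem product_le
  rw [Pi.add_apply]
  constructor <;> linarith

theorem card_patternPoints_quadScale_le {n : ℕ} (hn : 0 < n) {P : Finset ℕ}
    (prime : ∀ q ∈ P, q.Prime) (two_notMem : 2 ∉ P) {u : Fin n.totient → ℤ}
    (not_dvd : ∀ q ∈ P, ¬ (q : ℤ) ∣ cycloNorm n u) {b : ℕ} (hu : ∀ i, |u i| ≤ b) :
    3 ^ P.card * (patternPoints n (2 * cycloBound n * b * ∏ q ∈ P, q)
      (quadScale n (∏ q ∈ P, q)) u).card ≤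
      2 ^ P.card * (3 * (2 * cycloBound n * b * ∏ q ∈ P, q)) ^ n.totient := by
  set Q := ∏ q ∈ P, q
  set Y := patternPoints n (2 * cycloBound n * b * Q) (quadScale n Q) u
  have Q_pos : 0 < Q := Finset.prod_pos fun q hq => (prime q hq).pos
  have fact (q : P) : Fact (q : ℕ).Prime := ⟨prime q q.2⟩
  let V (q : P) := quadValues n fun i => (u i : ZMod q)
  have residue_mem : ∀ y ∈ Y, ∀ q : P, (fun i => (y i : ZMod q)) ∈ V q := by
    intro y hy q
    obtain ⟨x, -, rfl⟩ := Finset.mem_image.1 hy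
    have q_dvd : ((q : ℕ) : ℤ) ∣ Q := by exact_mod_cast Finset.dvd_prod_of_mem _ q.2
    exact intCast_add_cycloMul_mem_quadValues n fun i => q_dvd.trans (dvd_quadScale_sub n Q x i)
  have card_Y_le : Y.card ≤ (∏ q : P, (V q).card) * (6 * cycloBound n * b) ^ n.totient := by
    have := card_le_of_residues (fun q : P => (prime q q.2).pos)
      (fun p q hpq => (Nat.coprime_primes (prime p p.2) (prime q q.2)).2 (Subtype.coe_ne_coe.2 hpq))
      V (-(2 * cycloBound n * b)) (4 * cycloBound n * b) Y residue_mem fun y hy i => by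
        have := mem_Ico_of_mem_patternPoints_quadScale Q_pos hu hy i
        rw [← Nat.cast_prod, Finset.prod_coe_sort P fun q => q]
        exact this
    convert this using 2
    rw [Fintype.card_fin]
    congr 1
    zify
    rw [Int.toNat_of_nonneg] <;> ring_nf
    positivity
  have prod_card_le : 3 ^ P.card * ∏ q : P, (V q).card ≤ 2 ^ P.card * Q ^ n.totient := by
    have := Finset.prod_le_prod' (s := Finset.univ) fun (q : P) _ =>
      three_mul_card_quadValues_le hn (fun h => two_notMem (h ▸ q.2)) (not_dvd q q.2)
    rwa [Finset.prod_mul_distrib, Finset.prod_mul_distrib, Finset.prod_const, Finset.prod_const,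
      Finset.card_univ, Fintype.card_coe, Finset.prod_pow,
      Finset.prod_coe_sort P fun q => q] at this
  calc 3 ^ P.card * Y.card
      ≤ 3 ^ P.card * ((∏ q : P, (V q).card) * (6 * cycloBound n * b) ^ n.totient) := by gcongr
    _ ≤ 2 ^ P.card * Q ^ n.totient * (6 * cycloBound n * b) ^ n.totient := by
      rw [← mul_assoc]
      gcongr
    _ = 2 ^ P.card * (3 * (2 * cycloBound n * b * Q)) ^ n.totient := by
      rw [mul_assoc, ← mul_pow]
      ring

/-! ### Digit systems -/

/-- Digits `x` in some base `W` together with scaling factors `ρ(x)` such that the points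
`x + ρ(x) ⊗ u` number at most `W ^ s` for each `u ∈ U`. Expanding integers and reals in base `W`
transfers this bound to all scales. -/
structure DigitSystem (n : ℕ) (U : Finset (Fin n.totient → ℤ)) (s : ℝ) where
  base : ℕ
  two_le_base : 2 ≤ base
  scale : (Fin n.totient → ℤ) → (Fin n.totient → ℤ)
  one_le_scale : ∀ x i, 1 ≤ scale x i
  scale_le : ∀ x i, scale x i ≤ base
  card_le : ∀ u ∈ U, ((patternPoints n base scale u).card : ℝ) ≤ (base : ℝ) ^ s

theorem nonempty_digitSystem {n : ℕ} (hn : 0 < n) {U : Finset (Fin n.totient → ℤ)} {b : ℕ}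
    (hb : 0 < b) (hU : ∀ u ∈ U, ∀ i, |u i| ≤ b) {P : Finset ℕ} (prime : ∀ q ∈ P, q.Prime)
    (two_notMem : 2 ∉ P) (not_dvd : ∀ u ∈ U, ∀ q ∈ P, ¬ (q : ℤ) ∣ cycloNorm n u) {s : ℝ}
    (hs : (2 / 3 : ℝ) ^ P.card * (3 * (2 * cycloBound n * b * ∏ q ∈ P, q : ℕ)) ^ n.totient ≤
      ((2 * cycloBound n * b * ∏ q ∈ P, q : ℕ) : ℝ) ^ s) :
    Nonempty (DigitSystem n U s) := by
  have Q_pos : 0 < ∏ q ∈ P, q := Finset.prod_pos fun q hq => (prime q hq).pos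
  have Cb_pos : 0 < cycloBound n * b := mul_pos (cycloBound_pos n) hb
  exact ⟨{
    base := 2 * cycloBound n * b * ∏ q ∈ P, q
    two_le_base := by nlinarith
    scale := quadScale n (∏ q ∈ P, q)
    one_le_scale := fun x i => by
      have := (quadScale_mem_Ico n Q_pos x i).1
      omega
    scale_le := fun x i => by
      refine (quadScale_mem_Ico n Q_pos x i).2.le.trans ?_
      norm_cast
      nlinarith
    card_le := fun u hu => by
      refine le_trans ?_ hs
      have := card_patternPoints_quadScale_le hn prime two_notMem (not_dvd u hu) (hU u hu)
      rw [div_pow, div_mul_eq_mul_div, le_div_iff₀ (by positivity), mul_comm]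
      exact_mod_cast this }⟩

theorem eventually_log_le_mul {ε : ℝ} (hε : 0 < ε) : ∀ᶠ k : ℕ in atTop, Real.log k ≤ ε * k := by
  filter_upwards [tendsto_natCast_atTop_atTop.eventually
    (Real.isLittleO_log_id_atTop.bound hε)] with k hk
  simpa only [id_eq, Real.norm_natCast] using (le_abs_self _).trans hk

theorem eventually_pow_le_primeCounting (a : ℕ) :
    ∀ᶠ k : ℕ in atTop, k ^ a ≤ Nat.primeCounting (k ^ (a + 1)) := by
  have ε_pos : (0 : ℝ) < 1 / (8 * (a + 2)) := by positivity
  filter_upwards [eventually_log_le_mul ε_pos, eventually_ge_atTop 2] with k log_le two_le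
  have two_le' : (2 : ℝ) ≤ k := by exact_mod_cast two_le
  have log_pos : 0 < Real.log k := Real.log_pos (by linarith)
  rw [div_mul_eq_mul_div, le_div_iff₀ (by positivity)] at log_le
  have k_le : (k : ℝ) ≤ k ^ (a + 1) := le_self_pow₀ (by linarith) (by omega)
  have log_add_one_le : Real.log (k ^ (a + 1) + 1) ≤ (a + 2) * Real.log k := by
    have pow_add_one_le : (k : ℝ) ^ (a + 1) + 1 ≤ k ^ (a + 2) := by
      rw [pow_succ (k : ℝ) (a + 1)]
      nlinarith
    refine (Real.log_le_log (by positivity) pow_add_one_le).trans_eq ?_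
    rw [Real.log_pow]
    push_cast
    rfl
  have pow_mul_log_le : (k : ℝ) ^ a * ((a + 1) * Real.log k) ≤ k ^ (a + 1) / 8 := by
    rw [pow_succ, mul_div_assoc]
    gcongr
    linarith
  have half_le_log_two : (k : ℝ) ^ (a + 1) * (1 / 2) ≤ k ^ (a + 1) * Real.log 2 := by
    gcongr
    linarith [Real.one_sub_inv_le_log_of_pos (show (0 : ℝ) < 2 by norm_num)]
  have chebyshev := Chebyshev.pi_ge (k ^ (a + 1))
  push_cast at chebyshev
  refine Nat.cast_le (α := ℝ) |>.1 (le_trans ?_ chebyshev)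
  rw [Real.log_pow, le_div_iff₀ (by positivity)]
  push_cast
  linarith

theorem eventually_exists_primes {a : ℕ} (ha : a ≠ 0) :
    ∀ᶠ k : ℕ in atTop, ∀ S : Finset ℕ, S.card ≤ k ^ a →
      ∃ P : Finset ℕ, P.card = k ∧ Disjoint P S ∧ ∀ q ∈ P, q.Prime ∧ q ≤ k ^ (a + 2) := by
  filter_upwards [eventually_pow_le_primeCounting (a + 1), eventually_ge_atTop 2]
    with k pow_le_primeCounting two_le S hS
  have k_le : k ≤ (Nat.primesLE (k ^ (a + 2)) \ S).card := by
    have sdiff_card_ge := Finset.le_card_sdiff S (Nat.primesLE (k ^ (a + 2)))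
    rw [Nat.primesLE_card_eq_primeCounting] at sdiff_card_ge
    rw [show a + 1 + 1 = a + 2 from rfl] at pow_le_primeCounting
    have : k ≤ k ^ a := Nat.le_self_pow ha k
    have : 2 * k ^ a ≤ k ^ (a + 1) := by
      rw [pow_succ, mul_comm]
      gcongr
    omega
  obtain ⟨P, P_subset, P_card⟩ := Finset.exists_subset_card_eq k_le
  rw [Finset.subset_sdiff] at P_subset
  exact ⟨P, P_card, P_subset.2, fun q hq => (Nat.mem_primesLE.1 (P_subset.1 hq)).symm⟩

theorem two_pow_card_primeFactors_le {D : ℕ} (hD : D ≠ 0) : 2 ^ D.primeFactors.card ≤ D :=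
  (Finset.pow_card_le_prod _ _ _ fun _ hp => (Nat.prime_of_mem_primeFactors hp).two_le).trans
    (Nat.le_of_dvd (Nat.pos_of_ne_zero hD) (Nat.prod_primeFactors_dvd D))

/-- Finite sets `U` that are as large as the construction of a digit system out of `k` primes
allows. The bound `k ^ k` keeps the logarithm of the base of order `k log k`. -/
structure IsAdmissible {d : ℕ} (k : ℕ) (U : Finset (Fin d → ℤ)) : Prop where
  card_le : U.card ≤ k
  zero_notMem : 0 ∉ U
  abs_le : ∀ u ∈ U, ∀ i, |u i| ≤ (k : ℤ) ^ k

theorem IsAdmissible.prod_natAbs_cycloNorm_ne_zero {n : ℕ} (hn : 0 < n) {k : ℕ}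
    {U : Finset (Fin n.totient → ℤ)} (hU : IsAdmissible k U) :
    ∏ u ∈ U, (cycloNorm n u).natAbs ≠ 0 :=
  Finset.prod_ne_zero_iff.2 fun _ hu =>
    Int.natAbs_ne_zero.2 (cycloNorm_ne_zero hn (ne_of_mem_of_not_mem hu hU.zero_notMem))

theorem IsAdmissible.card_primeFactors_lt {n : ℕ} (hn : 0 < n) {k : ℕ}
    (hk : n.totient.factorial * cycloBound n ^ n.totient + n.totient < k)
    {U : Finset (Fin n.totient → ℤ)} (hU : IsAdmissible k U) :
    (∏ u ∈ U, (cycloNorm n u).natAbs).primeFactors.card < k ^ 4 := by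
  set D := n.totient.factorial * cycloBound n ^ n.totient
  have k_pos : 0 < k := by omega
  have norm_le (u) (hu : u ∈ U) : (cycloNorm n u).natAbs ≤ 2 ^ (D + k * k * n.totient) := calc
    (cycloNorm n u).natAbs ≤ n.totient.factorial * (cycloBound n * k ^ k) ^ n.totient :=
      natAbs_cycloNorm_le n fun i => by exact_mod_cast hU.abs_le u hu i
    _ = D * ((k ^ k) ^ n.totient) := by rw [mul_pow, mul_assoc]
    _ ≤ 2 ^ D * (((2 ^ k) ^ k) ^ n.totient) := by gcongr <;> exact Nat.lt_two_pow_self.le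
    _ = 2 ^ (D + k * k * n.totient) := by rw [pow_add, ← pow_mul, ← pow_mul, ← mul_assoc]
  have two_pow_le : 2 ^ (∏ u ∈ U, (cycloNorm n u).natAbs).primeFactors.card ≤
      2 ^ ((D + k * k * n.totient) * k) := calc
    _ ≤ ∏ u ∈ U, (cycloNorm n u).natAbs :=
      two_pow_card_primeFactors_le (hU.prod_natAbs_cycloNorm_ne_zero hn)
    _ ≤ (2 ^ (D + k * k * n.totient)) ^ U.card := Finset.prod_le_pow_card _ _ _ norm_le
    _ ≤ 2 ^ ((D + k * k * n.totient) * k) := by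
      rw [← pow_mul]
      exact Nat.pow_le_pow_right two_pos (Nat.mul_le_mul_left _ hU.card_le)
  calc _ ≤ (D + k * k * n.totient) * k := (Nat.pow_le_pow_iff_right one_lt_two).1 two_pow_le
    _ ≤ (k * k * (D + n.totient)) * k := by
      rw [mul_add]
      gcongr
      exact Nat.le_mul_of_pos_left D (by positivity)
    _ < (k * k * k) * k := by gcongr
    _ = k ^ 4 := by ring

theorem pow_mul_pow_le_rpow {d k : ℕ} (hk : 2 ≤ k) (hd : 15 * d ≤ k) {W : ℝ} (hW : 0 < W)
    (hWk : W ≤ (k : ℝ) ^ (8 * k)) :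
    (2 / 3 : ℝ) ^ k * (3 * W) ^ d ≤ W ^ (d - 1 / 40 / Real.log k) := by
  have log_pos : 0 < Real.log k := Real.log_pos (by exact_mod_cast hk)
  have hd' : 15 * (d : ℝ) ≤ k := by exact_mod_cast hd
  have exp_le : (2 / 3 : ℝ) ^ k * 3 ^ d ≤ Real.exp (-(k / 5)) := calc
    (2 / 3 : ℝ) ^ k * 3 ^ d ≤ Real.exp (-1 / 3) ^ k * Real.exp 2 ^ d := by
      gcongr <;> linarith [Real.add_one_le_exp (-1 / 3), Real.add_one_le_exp 2]
    _ = Real.exp (k * (-1 / 3) + d * 2) := by rw [Real.exp_add, Real.exp_nat_mul, Real.exp_nat_mul]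
    _ ≤ Real.exp (-(k / 5)) := Real.exp_le_exp.2 (by linarith)
  have exp_le_rpow : Real.exp (-(k / 5)) ≤ W ^ (-(1 / 40 / Real.log k)) := by
    have log_W_le := Real.log_le_log hW hWk
    rw [Real.log_pow] at log_W_le
    push_cast at log_W_le
    rw [Real.rpow_def_of_pos hW, Real.exp_le_exp, mul_neg, neg_le_neg_iff, ← mul_div_assoc,
      div_le_iff₀ log_pos]
    linarith
  calc (2 / 3 : ℝ) ^ k * (3 * W) ^ d = (2 / 3 : ℝ) ^ k * 3 ^ d * W ^ d := by rw [mul_pow]; ring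
    _ ≤ W ^ (-(1 / 40 / Real.log k)) * W ^ d := by gcongr; exact exp_le.trans exp_le_rpow
    _ = W ^ (d - 1 / 40 / Real.log k) := by
      rw [← Real.rpow_natCast W d, ← Real.rpow_add hW, neg_add_eq_sub]

theorem eventually_nonempty_digitSystem {n : ℕ} (hn : 0 < n) :
    ∀ᶠ k : ℕ in atTop, ∀ U : Finset (Fin n.totient → ℤ), IsAdmissible k U →
      Nonempty (DigitSystem n U (n.totient - 1 / 40 / Real.log k)) := by
  filter_upwards [eventually_exists_primes four_ne_zero, eventually_ge_atTop 2,
    eventually_ge_atTop (2 * cycloBound n), eventually_ge_atTop (15 * n.totient),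
    eventually_gt_atTop (n.totient.factorial * cycloBound n ^ n.totient + n.totient)]
    with k exists_primes two_le bound_le totient_le factorial_lt U hU
  set badPrimes := (∏ u ∈ U, (cycloNorm n u).natAbs).primeFactors
  obtain ⟨P, P_card, P_disjoint, hP⟩ := exists_primes (insert 2 badPrimes)
    ((Finset.card_insert_le _ _).trans (hU.card_primeFactors_lt hn factorial_lt))
  rw [Finset.disjoint_insert_right] at P_disjoint
  have prime (q) (hq : q ∈ P) : q.Prime := (hP q hq).1
  have not_dvd (u) (hu : u ∈ U) (q) (hq : q ∈ P) : ¬ (q : ℤ) ∣ cycloNorm n u := fun h =>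
    Finset.disjoint_left.1 P_disjoint.2 hq (Nat.mem_primeFactors.2 ⟨prime q hq,
      (Int.natCast_dvd.1 h).trans (Finset.dvd_prod_of_mem _ hu),
      hU.prod_natAbs_cycloNorm_ne_zero hn⟩)
  have prod_le : ∏ q ∈ P, q ≤ (k ^ 6) ^ k :=
    (Finset.prod_le_pow_card _ _ _ fun q hq => (hP q hq).2).trans_eq (by rw [P_card])
  have base_le : 2 * cycloBound n * k ^ k * ∏ q ∈ P, q ≤ k ^ (8 * k) := calc
    _ ≤ k ^ k * k ^ k * (k ^ 6) ^ k := by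
      gcongr
      exact bound_le.trans (Nat.le_self_pow (by omega) k)
    _ = k ^ (8 * k) := by rw [← pow_mul, ← pow_add, ← pow_add]; congr 1; omega
  have base_pos : 0 < 2 * cycloBound n * k ^ k * ∏ q ∈ P, q := by
    have := cycloBound_pos n
    have := Finset.prod_pos fun q hq => (prime q hq).pos
    positivity
  refine nonempty_digitSystem hn (b := k ^ k) (by positivity)
    (fun u hu i => by exact_mod_cast hU.abs_le u hu i) prime P_disjoint.1 not_dvd ?_
  rw [P_card]
  exact pow_mul_pow_le_rpow two_le totient_le (by exact_mod_cast base_pos)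
    (by exact_mod_cast base_le)

theorem add_cycloMul_mem_patternPoints {n M : ℕ} (r : (Fin n.totient → ℤ) → (Fin n.totient → ℤ))
    (u : Fin n.totient → ℤ) {x : Fin n.totient → ℤ} (hx : ∀ i, x i ∈ Set.Ico (0 : ℤ) M) :
    x + cycloMul n (r x) u ∈ patternPoints n M r u :=
  Finset.mem_image_of_mem _ (Fintype.mem_piFinset.2 fun i => Finset.mem_Ico.2 (hx i))

namespace DigitSystem

variable {n : ℕ} {U : Finset (Fin n.totient → ℤ)} {s : ℝ} (D : DigitSystem n U s)

/-- The scaling factor attached to `x` by applying `D.scale` to each of its `m` lowest digits. -/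
def factor : ℕ → (Fin n.totient → ℤ) → (Fin n.totient → ℤ)
  | 0, _ => 0
  | m + 1, x => (D.base : ℤ) • factor m (fun i => x i / D.base) + D.scale (fun i => x i % D.base)

theorem base_pos : 0 < D.base :=
  two_pos.trans_le D.two_le_base

theorem pow_le_factor (m : ℕ) (x : Fin n.totient → ℤ) (i : Fin n.totient) :
    (D.base : ℤ) ^ m ≤ D.factor (m + 1) x i := by
  have one_le := D.one_le_scale (fun i => x i % D.base) i
  induction m generalizing x with
  | zero => simpa [factor] using one_le
  | succ m ih =>
    rw [factor, Pi.add_apply, Pi.smul_apply, smul_eq_mul, pow_succ']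
    have := ih (fun i => x i / D.base) (D.one_le_scale _ i)
    exact le_add_of_le_of_nonneg (by gcongr) (by omega)

theorem add_factor_succ (m : ℕ) (x u : Fin n.totient → ℤ) :
    x + cycloMul n (D.factor (m + 1) x) u =
      (D.base : ℤ) • ((fun i => x i / D.base) +
        cycloMul n (D.factor m fun i => x i / D.base) u) +
      ((fun i => x i % D.base) + cycloMul n (D.scale fun i => x i % D.base) u) := by
  simp only [factor, ← cycloMulHom_apply, map_add, map_smul, LinearMap.add_apply,
    LinearMap.smul_apply]
  funext i
  simp only [Pi.add_apply, Pi.smul_apply, smul_eq_mul]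
  linear_combination -Int.mul_ediv_add_emod (x i) D.base

open Classical in
theorem patternPoints_factor_succ_subset (m : ℕ) (u : Fin n.totient → ℤ) :
    patternPoints n (D.base ^ (m + 1)) (D.factor (m + 1)) u ⊆
      Finset.image₂ (fun y z => (D.base : ℤ) • y + z)
        (patternPoints n (D.base ^ m) (D.factor m) u) (patternPoints n D.base D.scale u) := by
  have base_pos : (0 : ℤ) < D.base := by exact_mod_cast D.base_pos
  intro y hy
  obtain ⟨x, hx, rfl⟩ := Finset.mem_image.1 hy
  have x_mem (i) := Finset.mem_Ico.1 (Fintype.mem_piFinset.1 hx i)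
  have quotient_lt (i) : x i / D.base < (D.base ^ m : ℕ) := by
    rw [Int.ediv_lt_iff_lt_mul base_pos]
    exact_mod_cast pow_succ D.base m ▸ (x_mem i).2
  refine Finset.mem_image₂.2 ⟨_, add_cycloMul_mem_patternPoints _ _ fun i => ?_,
    _, add_cycloMul_mem_patternPoints _ _ fun i => ?_, (D.add_factor_succ m x u).symm⟩
  · exact ⟨Int.ediv_nonneg (x_mem i).1 base_pos.le, quotient_lt i⟩
  · exact ⟨Int.emod_nonneg _ base_pos.ne', Int.emod_lt_of_pos _ base_pos⟩

theorem card_patternPoints_factor_le {u : Fin n.totient → ℤ} (hu : u ∈ U) (m : ℕ) :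
    ((patternPoints n (D.base ^ m) (D.factor m) u).card : ℝ) ≤ ((D.base : ℝ) ^ m) ^ s := by
  classical
  induction m with
  | zero =>
    have card_le_one := Finset.card_image_le (s := Fintype.piFinset fun _ => Finset.Ico (0 : ℤ) 1)
      (f := fun x => x + cycloMul n (D.factor 0 x) u)
    simpa [patternPoints] using card_le_one
  | succ m ih =>
    calc ((patternPoints n (D.base ^ (m + 1)) (D.factor (m + 1)) u).card : ℝ)
        ≤ (patternPoints n (D.base ^ m) (D.factor m) u).card *
            (patternPoints n D.base D.scale u).card := by
          exact_mod_cast (Finset.card_le_card (D.patternPoints_factor_succ_subset m u)).trans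
            (Finset.card_image₂_le _ _ _)
      _ ≤ ((D.base : ℝ) ^ m) ^ s * (D.base : ℝ) ^ s := by gcongr; exact D.card_le u hu
      _ = ((D.base : ℝ) ^ (m + 1)) ^ s := by
          rw [pow_succ, Real.mul_rpow (by positivity) (by positivity)]

theorem containsPattern_biUnion_patternPoints (hn : 0 < n) [DecidableEq (Fin n.totient → ℤ)]
    {m : ℕ} {x : Fin n.totient → ℤ} (hx : ∀ i, x i ∈ Set.Ico (0 : ℤ) ((D.base : ℤ) ^ (m + 1))) :
    ContainsPattern n U (U.biUnion (patternPoints n (D.base ^ (m + 1)) (D.factor (m + 1))) :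
      Set (Fin n.totient → ℤ)) x := by
  refine ⟨D.factor (m + 1) x, fun factor_eq_zero => ?_, fun u hu => ?_⟩
  · have pow_pos : (0 : ℤ) < (D.base : ℤ) ^ m := pow_pos (by exact_mod_cast D.base_pos) _
    have pow_le := D.pow_le_factor m x ⟨0, Nat.totient_pos.2 hn⟩
    rw [factor_eq_zero, Pi.zero_apply] at pow_le
    exact pow_pos.not_ge pow_le
  · refine Finset.mem_coe.2 (Finset.mem_biUnion.2 ⟨u, hu, ?_⟩)
    exact add_cycloMul_mem_patternPoints _ _ fun i => by exact_mod_cast hx i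

end DigitSystem

theorem DigitSystem.eventually_exists_finset {n : ℕ} (hn : 0 < n)
    {U : Finset (Fin n.totient → ℤ)} {s t : ℝ} (D : DigitSystem n U s) (hs : 0 ≤ s) (hst : s < t) :
    ∀ᶠ N : ℕ in atTop, ∃ B : Finset (Fin n.totient → ℤ),
      (∀ x : Fin n.totient → ℤ, (∀ i, x i ∈ Finset.Icc (1 : ℤ) N) →
        ContainsPattern n U (B : Set (Fin n.totient → ℤ)) x) ∧ (B.card : ℝ) < (N : ℝ) ^ t := by
  classical
  have eventually_lt : ∀ᶠ N : ℕ in atTop, U.card * (D.base : ℝ) ^ s < (N : ℝ) ^ (t - s) :=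
    ((tendsto_rpow_atTop (sub_pos.2 hst)).comp tendsto_natCast_atTop_atTop).eventually_gt_atTop _
  filter_upwards [eventually_lt, eventually_gt_atTop 0] with N lt_rpow N_pos
  set m := Nat.log D.base N
  let points := patternPoints n (D.base ^ (m + 1)) (D.factor (m + 1))
  have lt_pow : (N : ℤ) < (D.base : ℤ) ^ (m + 1) := by
    exact_mod_cast Nat.lt_pow_succ_log_self D.two_le_base N
  refine ⟨U.biUnion points, fun x hx => D.containsPattern_biUnion_patternPoints hn fun i => ?_, ?_⟩
  · have x_mem := Finset.mem_Icc.1 (hx i)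
    exact ⟨by omega, by omega⟩
  · calc ((U.biUnion points).card : ℝ)
        ≤ ∑ u ∈ U, ((points u).card : ℝ) := by exact_mod_cast Finset.card_biUnion_le
      _ ≤ ∑ _u ∈ U, ((D.base : ℝ) ^ (m + 1)) ^ s :=
          Finset.sum_le_sum fun u hu => D.card_patternPoints_factor_le hu (m + 1)
      _ = U.card * (D.base : ℝ) ^ s * ((D.base : ℝ) ^ m) ^ s := by
          rw [Finset.sum_const, nsmul_eq_mul, pow_succ,
            Real.mul_rpow (by positivity) (by positivity), mul_comm (((D.base : ℝ) ^ m) ^ s),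
            mul_assoc]
      _ ≤ U.card * (D.base : ℝ) ^ s * (N : ℝ) ^ s := by
          gcongr
          exact_mod_cast Nat.pow_log_le_self D.base N_pos.ne'
      _ < (N : ℝ) ^ (t - s) * (N : ℝ) ^ s := by gcongr
      _ = (N : ℝ) ^ t := by rw [← Real.rpow_add (by exact_mod_cast N_pos), sub_add_cancel]

/-! ### Box dimension -/

/-- For all scales `ε < 1` the set `E` is covered by `O(ε ^ (-s))` closed balls of radius `ε`. -/
def HasCoverings {X : Type*} [PseudoMetricSpace X] (E : Set X) (s : ℝ) : Prop :=
  ∃ C : ℝ, 0 < C ∧ ∀ ε ∈ Set.Ioo (0 : ℝ) 1, ∃ P : Finset X,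
    (P.card : ℝ) ≤ C * (1 / ε) ^ s ∧ E ⊆ ⋃ p ∈ P, Metric.closedBall p ε

/-- For all scales `ε < 1` the set `E` contains `≫ ε ^ (-s)` points at mutual distances
larger than `ε`. -/
def HasPackings {X : Type*} [PseudoMetricSpace X] (E : Set X) (s : ℝ) : Prop :=
  ∃ c : ℝ, 0 < c ∧ ∀ ε ∈ Set.Ioo (0 : ℝ) 1, ∃ A : Finset X,
    c * (1 / ε) ^ s ≤ A.card ∧ ↑A ⊆ E ∧ (A : Set X).Pairwise fun a b => ε < dist a b

section PseudoMetricSpace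

variable {X : Type*} [PseudoMetricSpace X] {E F : Set X} {s : ℝ}

theorem HasCoverings.union (hE : HasCoverings E s) (hF : HasCoverings F s) :
    HasCoverings (E ∪ F) s := by
  classical
  obtain ⟨C, C_pos, hE⟩ := hE
  obtain ⟨D, D_pos, hF⟩ := hF
  refine ⟨C + D, by positivity, fun ε hε => ?_⟩
  obtain ⟨P, P_card, E_subset⟩ := hE ε hε
  obtain ⟨Q, Q_card, F_subset⟩ := hF ε hε
  refine ⟨P ∪ Q, ?_, ?_⟩
  · rw [add_mul]
    exact (Nat.cast_le.2 (Finset.card_union_le P Q)).trans (by push_cast; gcongr)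
  · rw [Finset.set_biUnion_union]
    exact Set.union_subset_union E_subset F_subset

theorem HasCoverings.biUnion {ι : Type*} (I : Finset ι) {E : ι → Set X}
    (hE : ∀ i ∈ I, HasCoverings (E i) s) : HasCoverings (⋃ i ∈ I, E i) s := by
  classical
  induction I using Finset.induction_on with
  | empty =>
    refine ⟨1, one_pos, fun ε ⟨ε_pos, _⟩ => ⟨∅, ?_, by simp⟩⟩
    rw [Finset.card_empty, Nat.cast_zero]
    positivity
  | insert i I _ ih =>
    rw [Finset.set_biUnion_insert]
    exact (hE i (Finset.mem_insert_self _ _)).union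
      (ih fun j hj => hE j (Finset.mem_insert_of_mem hj))

theorem HasCoverings.closure (hE : HasCoverings E s) : HasCoverings (closure E) s := by
  obtain ⟨C, C_pos, hE⟩ := hE
  refine ⟨C, C_pos, fun ε hε => ?_⟩
  obtain ⟨P, P_card, subset⟩ := hE ε hε
  exact ⟨P, P_card, closure_minimal subset
    (P.finite_toSet.isClosed_biUnion fun _ _ => Metric.isClosed_closedBall)⟩

theorem HasCoverings.isCompact_closure [ProperSpace X] (hE : HasCoverings E s) :
    IsCompact (_root_.closure E) := by
  obtain ⟨C, -, hE⟩ := hE.closure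
  obtain ⟨P, -, subset⟩ := hE (1 / 2) (by norm_num)
  exact (P.finite_toSet.isCompact_biUnion fun p _ =>
    isCompact_closedBall p _).of_isClosed_subset isClosed_closure subset

theorem HasPackings.mono (hE : HasPackings E s) (hEF : E ⊆ F) : HasPackings F s := by
  obtain ⟨c, c_pos, hE⟩ := hE
  refine ⟨c, c_pos, fun ε hε => ?_⟩
  obtain ⟨A, A_card, A_subset, separated⟩ := hE ε hε
  exact ⟨A, A_card, A_subset.trans hEF, separated⟩

theorem HasCoverings.of_approximations {W κ C : ℝ} (hW : 1 < W) (hκ : 1 ≤ κ) (hC : 0 < C)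
    (hs : 0 ≤ s) (Z : ℕ → Finset X) (card_le : ∀ j, ((Z j).card : ℝ) ≤ C * (W ^ j) ^ s)
    (approx : ∀ y ∈ E, ∀ j, ∃ z ∈ Z j, dist y z ≤ κ / W ^ j) : HasCoverings E s := by
  have : 0 < W := one_pos.trans hW
  refine ⟨C * (W * κ) ^ s, by positivity, fun ε ⟨ε_pos, ε_lt⟩ => ?_⟩
  have one_le : 1 ≤ κ * (1 / ε) := one_le_mul_of_one_le_of_one_le hκ
    ((one_le_div ε_pos).2 ε_lt.le)
  obtain ⟨j, pow_le, lt_pow⟩ := exists_nat_pow_near one_le hW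
  refine ⟨Z (j + 1), ?_, fun y hy => ?_⟩
  · calc ((Z (j + 1)).card : ℝ) ≤ C * (W ^ (j + 1)) ^ s := card_le _
      _ ≤ C * (W * (κ * (1 / ε))) ^ s := by rw [pow_succ']; gcongr
      _ = C * (W * κ) ^ s * (1 / ε) ^ s := by
          rw [← mul_assoc, Real.mul_rpow (by positivity) (by positivity), mul_assoc]
  · obtain ⟨z, hz, dist_le⟩ := approx y hy (j + 1)
    refine Set.mem_iUnion₂.2 ⟨z, hz, dist_le.trans ?_⟩
    rw [mul_one_div, div_lt_iff₀ ε_pos] at lt_pow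
    rw [div_le_iff₀ (by positivity), mul_comm]
    exact lt_pow.le

end PseudoMetricSpace

theorem exists_cubes_of_subset_closedBall {d : ℕ} {E : Set (Fin d → ℝ)} {ε : ℝ}
    {P : Finset (Fin d → ℝ)} (hE : E ⊆ ⋃ p ∈ P, Metric.closedBall p (ε / 2)) :
    ∃ a : Fin P.card → (Fin d → ℝ), E ⊆ ⋃ j, Set.Icc (a j) fun i => a j i + ε := by
  refine ⟨fun j i => (P.equivFin.symm j : Fin d → ℝ) i - ε / 2, fun x hx => ?_⟩
  obtain ⟨p, hp, mem_ball⟩ := Set.mem_iUnion₂.1 (hE hx)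
  have dist_le (i : Fin d) := abs_le.1 ((dist_le_pi_dist x p i).trans mem_ball)
  refine Set.mem_iUnion.2 ⟨P.equivFin ⟨p, hp⟩, ?_⟩
  simp only [Equiv.symm_apply_apply]
  exact ⟨fun i => by dsimp only; linarith [(dist_le i).1],
    fun i => by dsimp only; linarith [(dist_le i).2]⟩

theorem boxCount_le_card {d : ℕ} {E : Set (Fin d → ℝ)} {ε : ℝ} {P : Finset (Fin d → ℝ)}
    (hP : P.Nonempty) (hE : E ⊆ ⋃ p ∈ P, Metric.closedBall p (ε / 2)) :
    boxCount E ε ≤ P.card :=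
  Nat.sInf_le ⟨hP.card_pos, exists_cubes_of_subset_closedBall hE⟩

theorem card_le_boxCount {d : ℕ} {E : Set (Fin d → ℝ)} {ε : ℝ} (hε : 0 ≤ ε)
    {P : Finset (Fin d → ℝ)} (hP : P.Nonempty) (hE : E ⊆ ⋃ p ∈ P, Metric.closedBall p (ε / 2))
    {A : Finset (Fin d → ℝ)} (hA : ↑A ⊆ E)
    (separated : (A : Set (Fin d → ℝ)).Pairwise fun a b => ε < dist a b) :
    A.card ≤ boxCount E ε := by
  obtain ⟨-, a, subset⟩ := Nat.sInf_mem
    (⟨P.card, hP.card_pos, exists_cubes_of_subset_closedBall hE⟩ : Set.Nonempty {m : ℕ | 0 < m ∧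
      ∃ a : Fin m → (Fin d → ℝ), E ⊆ ⋃ j, Set.Icc (a j) fun i => a j i + ε})
  choose cube mem_cube using fun x : A => Set.mem_iUnion.1 (subset (hA x.2))
  have injective : Function.Injective cube := by
    intro x y hxy
    by_contra x_ne_y
    refine (separated x.2 y.2 (Subtype.coe_ne_coe.2 x_ne_y)).not_ge ((dist_pi_le_iff hε).2
      fun i => ?_)
    simpa using Real.dist_le_of_mem_Icc ⟨(mem_cube x).1 i, (mem_cube x).2 i⟩
      (hxy ▸ ⟨(mem_cube y).1 i, (mem_cube y).2 i⟩)
  rw [← Fintype.card_coe A, ← Fintype.card_fin (boxCount E ε)]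
  exact Fintype.card_le_of_injective cube injective

theorem tendsto_log_div_log_one_div {f : ℝ → ℝ} {s c C : ℝ} (hc : 0 < c) (hC : 0 < C)
    (le_f : ∀ᶠ ε in 𝓝[>] 0, c * (1 / ε) ^ s ≤ f ε)
    (f_le : ∀ᶠ ε in 𝓝[>] 0, f ε ≤ C * (1 / ε) ^ s) :
    Tendsto (fun ε => Real.log (f ε) / Real.log (1 / ε)) (𝓝[>] 0) (𝓝 s) := by
  have tendsto_log : Tendsto (fun ε : ℝ => Real.log (1 / ε)) (𝓝[>] 0) atTop := by
    simp only [one_div]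
    exact Real.tendsto_log_atTop.comp tendsto_inv_nhdsGT_zero
  have tendsto_add (K : ℝ) :
      Tendsto (fun ε => Real.log K / Real.log (1 / ε) + s) (𝓝[>] 0) (𝓝 s) := by
    simpa using (tendsto_log.const_div_atTop (Real.log K)).add_const s
  have log_div_eq {K ε : ℝ} (hK : 0 < K) (hε : 0 < ε) (log_pos : 0 < Real.log (1 / ε)) :
      Real.log (K * (1 / ε) ^ s) / Real.log (1 / ε) = Real.log K / Real.log (1 / ε) + s := by
    rw [Real.log_mul hK.ne' (by positivity), Real.log_rpow (by positivity), add_div,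
      mul_div_cancel_right₀ _ log_pos.ne']
  have pos := self_mem_nhdsWithin (a := (0 : ℝ)) (s := Set.Ioi 0)
  refine tendsto_of_tendsto_of_tendsto_of_le_of_le' (tendsto_add c) (tendsto_add C) ?_ ?_
  · filter_upwards [pos, tendsto_log.eventually_gt_atTop 0, le_f] with ε hε log_pos h
    rw [Set.mem_Ioi] at hε
    rw [← log_div_eq hc hε log_pos]
    gcongr
  · filter_upwards [pos, tendsto_log.eventually_gt_atTop 0, le_f, f_le] with ε hε log_pos h h'
    rw [Set.mem_Ioi] at hε
    rw [← log_div_eq hC hε log_pos]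
    gcongr
    exact lt_of_lt_of_le (by positivity) h

theorem minkowskiDim_eq {d : ℕ} {E : Set (Fin d → ℝ)} {s : ℝ} (covers : HasCoverings E s)
    (packs : HasPackings E s) : minkowskiDim E = s := by
  obtain ⟨C, C_pos, covers⟩ := covers
  obtain ⟨c, c_pos, packs⟩ := packs
  have bounds : ∀ ε ∈ Set.Ioo (0 : ℝ) 1, c * (1 / ε) ^ s ≤ boxCount E ε ∧
      boxCount E ε ≤ C * 2 ^ s * (1 / ε) ^ s := by
    intro ε ⟨ε_pos, ε_lt⟩
    obtain ⟨P, P_card, E_subset⟩ := covers (ε / 2) ⟨by linarith, by linarith⟩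
    obtain ⟨A, A_card, A_subset, separated⟩ := packs ε ⟨ε_pos, ε_lt⟩
    have A_nonempty : A.Nonempty := by
      rw [← Finset.card_pos, ← Nat.cast_pos (α := ℝ)]
      exact lt_of_lt_of_le (by positivity) A_card
    have P_nonempty : P.Nonempty := by
      obtain ⟨x, hx⟩ := A_nonempty
      obtain ⟨p, hp, -⟩ := Set.mem_iUnion₂.1 (E_subset (A_subset hx))
      exact ⟨p, hp⟩
    refine ⟨A_card.trans (Nat.cast_le.2
        (card_le_boxCount ε_pos.le P_nonempty E_subset A_subset separated)),
      (Nat.cast_le.2 (boxCount_le_card P_nonempty E_subset)).trans (P_card.trans_eq ?_)⟩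
    rw [mul_assoc, ← Real.mul_rpow (by positivity) (by positivity)]
    congr 2
    field_simp
  have small : Set.Ioo (0 : ℝ) 1 ∈ 𝓝[>] 0 := Ioo_mem_nhdsGT one_pos
  have tendsto := tendsto_log_div_log_one_div (f := fun ε => boxCount E ε) (s := s) c_pos
    (by positivity : 0 < C * 2 ^ s)
    (by filter_upwards [small] with ε hε using (bounds ε hε).1)
    (by filter_upwards [small] with ε hε using (bounds ε hε).2)
  exact ((continuous_coe_real_ereal.tendsto s).comp tendsto).limsup_eq

/-- The points of scale `2 ^ (-j)` with about `2 ^ (θ j)` values for each coordinate. -/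
noncomputable def gridPoints (d : ℕ) (θ : ℝ) (j : ℕ) : Finset (Fin d → ℝ) :=
  (Fintype.piFinset fun _ : Fin d => Finset.range ⌈((2 : ℝ) ^ j) ^ θ⌉₊).image
    fun a i => (a i : ℝ) / 2 ^ j

/-- A union of grids at all dyadic scales, of box dimension exactly `d θ`. -/
def multiscaleGrid (d : ℕ) (θ : ℝ) : Set (Fin d → ℝ) :=
  ⋃ j, gridPoints d θ j

theorem mem_gridPoints {d : ℕ} {θ : ℝ} {j : ℕ} {y : Fin d → ℝ} :
    y ∈ gridPoints d θ j ↔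
      ∃ a : Fin d → ℕ, (∀ i, (a i : ℝ) < ((2 : ℝ) ^ j) ^ θ) ∧ (fun i => (a i : ℝ) / 2 ^ j) = y := by
  simp only [gridPoints, Finset.mem_image, Fintype.mem_piFinset, Finset.mem_range, Nat.lt_ceil]

theorem card_gridPoints (d : ℕ) (θ : ℝ) (j : ℕ) :
    (gridPoints d θ j).card = ⌈((2 : ℝ) ^ j) ^ θ⌉₊ ^ d := by
  have injective : Function.Injective fun (a : Fin d → ℕ) i => (a i : ℝ) / 2 ^ j := by
    intro a b hab
    funext i
    have := congrFun hab i
    rwa [div_left_inj' (by positivity), Nat.cast_inj] at this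
  rw [gridPoints, Finset.card_image_of_injective _ injective, Fintype.card_piFinset_const,
    Finset.card_range]

theorem pow_rpow_le_card_gridPoints (d : ℕ) (θ : ℝ) (j : ℕ) :
    ((2 : ℝ) ^ j) ^ (d * θ) ≤ (gridPoints d θ j).card := by
  rw [card_gridPoints, mul_comm, Real.rpow_mul_natCast (by positivity)]
  push_cast
  gcongr
  exact Nat.le_ceil _

theorem card_gridPoints_le (d : ℕ) {θ : ℝ} (hθ : 0 ≤ θ) (j : ℕ) :
    ((gridPoints d θ j).card : ℝ) ≤ 2 ^ d * ((2 : ℝ) ^ j) ^ (d * θ) := by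
  have one_le : (1 : ℝ) ≤ ((2 : ℝ) ^ j) ^ θ := Real.one_le_rpow (one_le_pow₀ one_le_two) hθ
  have ceil_lt := Nat.ceil_lt_add_one (zero_le_one.trans one_le)
  rw [card_gridPoints, mul_comm (d : ℝ), Real.rpow_mul_natCast (by positivity), ← mul_pow]
  push_cast
  gcongr
  linarith

theorem sum_card_gridPoints_le {d : ℕ} {θ : ℝ} (hd : 0 < d) (hθ : 0 < θ) (J : ℕ) :
    ∑ j ∈ Finset.range (J + 1), ((gridPoints d θ j).card : ℝ) ≤
      2 ^ d * (2 ^ (d * θ) / (2 ^ (d * θ) - 1)) * ((2 : ℝ) ^ J) ^ (d * θ) := by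
  set x : ℝ := 2 ^ (d * θ)
  have pow_rpow (j : ℕ) : ((2 : ℝ) ^ j) ^ (d * θ) = x ^ j :=
    (Real.rpow_pow_comm zero_le_two _ _).symm
  have one_lt : 1 < x := Real.one_lt_rpow one_lt_two (by positivity)
  have : 0 < x - 1 := sub_pos.2 one_lt
  calc ∑ j ∈ Finset.range (J + 1), ((gridPoints d θ j).card : ℝ)
      ≤ ∑ j ∈ Finset.range (J + 1), 2 ^ d * x ^ j :=
        Finset.sum_le_sum fun j _ => (card_gridPoints_le d hθ.le j).trans_eq (by rw [pow_rpow])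
    _ = 2 ^ d * ((x ^ (J + 1) - 1) / (x - 1)) := by rw [← Finset.mul_sum, geom_sum_eq one_lt.ne']
    _ ≤ 2 ^ d * (x ^ (J + 1) / (x - 1)) := by gcongr; exact sub_le_self _ zero_le_one
    _ = 2 ^ d * (x / (x - 1)) * (2 ^ J) ^ (d * θ) := by rw [pow_rpow]; ring

theorem exists_mem_gridPoints_dist_le {d : ℕ} {θ : ℝ} (hθ : θ ≤ 1) {J m : ℕ}
    {y : Fin d → ℝ} (hy : y ∈ gridPoints d θ (J + m)) :
    ∃ z ∈ gridPoints d θ J, dist y z ≤ 1 / 2 ^ J := by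
  obtain ⟨a, a_lt, rfl⟩ := mem_gridPoints.1 hy
  have two_pow_pos (m : ℕ) : (0 : ℝ) < 2 ^ m := by positivity
  refine ⟨_, mem_gridPoints.2 ⟨fun i => a i / 2 ^ m, fun i => ?_, rfl⟩,
    (dist_pi_le_iff (by positivity)).2 fun i => ?_⟩
  · calc ((a i / 2 ^ m : ℕ) : ℝ) ≤ a i / 2 ^ m := by exact_mod_cast Nat.cast_div_le
      _ < (2 ^ (J + m)) ^ θ / 2 ^ m := by gcongr; exact a_lt i
      _ ≤ (2 ^ J) ^ θ := by
        rw [pow_add, Real.mul_rpow (by positivity) (by positivity), div_le_iff₀ (two_pow_pos m)]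
        gcongr
        exact Real.rpow_le_self_of_one_le (one_le_pow₀ one_le_two) hθ
  · have remainder_lt : ((a i % 2 ^ m : ℕ) : ℝ) ≤ 2 ^ m := by
      exact_mod_cast (Nat.mod_lt (a i) (by positivity)).le
    have decomposition : (2 : ℝ) ^ m * (a i / 2 ^ m : ℕ) + (a i % 2 ^ m : ℕ) = a i := by
      exact_mod_cast Nat.div_add_mod (a i) (2 ^ m)
    have sub_eq : (a i : ℝ) / 2 ^ (J + m) - (a i / 2 ^ m : ℕ) / 2 ^ J =
        (a i % 2 ^ m : ℕ) / 2 ^ m / 2 ^ J := by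
      rw [← decomposition, pow_add]
      field_simp
      simp
    rw [Real.dist_eq, sub_eq, abs_of_nonneg (by positivity)]
    gcongr
    exact (div_le_one (two_pow_pos m)).2 remainder_lt

theorem hasCoverings_multiscaleGrid {d : ℕ} {θ : ℝ} (hd : 0 < d) (hθ_pos : 0 < θ)
    (hθ : θ ≤ 1) : HasCoverings (multiscaleGrid d θ) (d * θ) := by
  classical
  have one_lt : (1 : ℝ) < 2 ^ (d * θ) := Real.one_lt_rpow one_lt_two (by positivity)
  have : (0 : ℝ) < 2 ^ (d * θ) - 1 := sub_pos.2 one_lt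
  refine HasCoverings.of_approximations (C := 2 ^ d * (2 ^ (d * θ) / (2 ^ (d * θ) - 1)))
    one_lt_two le_rfl (by positivity) (by positivity)
    (fun J => (Finset.range (J + 1)).biUnion (gridPoints d θ)) (fun J => ?_) fun y hy J => ?_
  · exact (Nat.cast_le.2 Finset.card_biUnion_le).trans
      (by exact_mod_cast sum_card_gridPoints_le hd hθ_pos J)
  · obtain ⟨j, hj⟩ := Set.mem_iUnion.1 hy
    rcases le_total j J with j_le | J_le
    · exact ⟨y, Finset.mem_biUnion.2 ⟨j, Finset.mem_range_succ_iff.2 j_le, hj⟩, by simp⟩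
    · obtain ⟨m, rfl⟩ := Nat.exists_eq_add_of_le J_le
      obtain ⟨z, hz, dist_le⟩ := exists_mem_gridPoints_dist_le hθ hj
      exact ⟨z, Finset.mem_biUnion.2 ⟨J, Finset.self_mem_range_succ J, hz⟩, dist_le⟩

theorem one_div_le_dist_of_mem_gridPoints {d : ℕ} {θ : ℝ} {j : ℕ} {y z : Fin d → ℝ}
    (hy : y ∈ gridPoints d θ j) (hz : z ∈ gridPoints d θ j) (y_ne_z : y ≠ z) :
    1 / 2 ^ j ≤ dist y z := by
  obtain ⟨a, -, rfl⟩ := mem_gridPoints.1 hy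
  obtain ⟨b, -, rfl⟩ := mem_gridPoints.1 hz
  obtain ⟨i, hi⟩ := Function.ne_iff.1 y_ne_z
  have a_ne_b : (a i : ℤ) ≠ b i := fun h => hi (by rw [Int.ofNat_inj.1 h])
  have one_le : (1 : ℝ) ≤ |(a i : ℝ) - b i| := by
    exact_mod_cast Int.one_le_abs (sub_ne_zero.2 a_ne_b)
  refine le_trans ?_ (dist_le_pi_dist _ _ i)
  rw [Real.dist_eq, ← sub_div, abs_div, abs_of_pos (by positivity : (0 : ℝ) < 2 ^ j)]
  gcongr

theorem hasPackings_multiscaleGrid (d : ℕ) {θ : ℝ} (hθ : 0 ≤ θ) :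
    HasPackings (multiscaleGrid d θ) (d * θ) := by
  refine ⟨(1 / 4) ^ (d * θ), by positivity, fun ε ⟨ε_pos, ε_lt⟩ => ?_⟩
  obtain ⟨j, pow_lt, le_pow⟩ : ∃ j : ℕ, (2 : ℝ) ^ j < 1 / ε ∧ 1 / ε ≤ 4 * 2 ^ j := by
    obtain ⟨j, pow_le, lt_pow⟩ := exists_nat_pow_near ((one_le_div ε_pos).2 ε_lt.le) one_lt_two
    rcases j with - | j
    · exact ⟨0, by simpa using (one_lt_div ε_pos).2 ε_lt, by linarith⟩
    · rw [pow_succ] at pow_le lt_pow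
      exact ⟨j, by linarith [pow_pos (two_pos (α := ℝ)) j], by rw [pow_succ] at lt_pow; linarith⟩
  refine ⟨gridPoints d θ j, ?_, fun y hy => Set.mem_iUnion.2 ⟨j, hy⟩,
    fun y hy z hz y_ne_z => ?_⟩
  · rw [← Real.mul_rpow (by positivity) (by positivity)]
    refine le_trans ?_ (pow_rpow_le_card_gridPoints d θ j)
    gcongr
    linarith
  · exact ((lt_one_div (by positivity) ε_pos).1 pow_lt).trans_le
      (one_div_le_dist_of_mem_gridPoints hy hz y_ne_z)

/-! ### Real patterns -/

theorem dist_floor_div_le {ι : Type*} [Fintype ι] {w : ℝ} (hw : 0 < w) (x : ι → ℝ) :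
    dist x (fun i => (⌊w * x i⌋ : ℝ) / w) ≤ 1 / w := by
  refine (dist_pi_le_iff (by positivity)).2 fun i => ?_
  have sub_eq : x i - ⌊w * x i⌋ / w = Int.fract (w * x i) / w := by
    rw [← Int.self_sub_floor]
    field_simp
  rw [Real.dist_eq, sub_eq, abs_of_nonneg (div_nonneg (Int.fract_nonneg _) hw.le)]
  gcongr
  exact (Int.fract_lt_one _).le

theorem dist_cycloMul_le (n : ℕ) (r r' u : Fin n.totient → ℝ) :
    dist (cycloMul n r u) (cycloMul n r' u) ≤ cycloBound n * dist r r' * ‖u‖ := by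
  have := norm_cycloMul_le n (r - r') u
  rwa [← cycloMulHom_apply, map_sub, LinearMap.sub_apply, ← dist_eq_norm, ← dist_eq_norm] at this

namespace DigitSystem

variable {n : ℕ} {U : Finset (Fin n.totient → ℤ)} {s : ℝ} (D : DigitSystem n U s)

/-- The integer vector `⌊D.base ^ j * x⌋`: `x` truncated to `j` digits after the radix point. -/
noncomputable def truncation (x : Fin n.totient → ℝ) (j : ℕ) : Fin n.totient → ℤ :=
  fun i => ⌊(D.base : ℝ) ^ j * x i⌋

/-- The scaling factor attached to the truncation of the real vector `x` to `j` digits after the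
radix point. -/
noncomputable def realApprox (x : Fin n.totient → ℝ) (j : ℕ) : Fin n.totient → ℝ :=
  fun i => (D.factor (j + 1) (D.truncation x j) i : ℝ) / (D.base : ℝ) ^ j

theorem two_le_base_real : (2 : ℝ) ≤ D.base := by
  exact_mod_cast D.two_le_base

theorem one_div_base_le : 1 / (D.base : ℝ) ≤ 1 / 2 :=
  one_div_le_one_div_of_le two_pos D.two_le_base_real

theorem realApprox_succ (x : Fin n.totient → ℝ) (j : ℕ) (i : Fin n.totient) :
    D.realApprox x (j + 1) i = D.realApprox x j i +
      (D.scale (fun i => D.truncation x (j + 1) i % D.base) i : ℝ) / (D.base : ℝ) ^ (j + 1) := by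
  have base_pos : (0 : ℝ) < D.base := two_pos.trans_le D.two_le_base_real
  have truncation_ediv : (fun i => D.truncation x (j + 1) i / (D.base : ℤ)) = D.truncation x j := by
    funext i
    rw [truncation, ← Int.floor_div_natCast, pow_succ, truncation]
    congr 1
    field_simp
  rw [realApprox, factor, truncation_ediv, realApprox, Pi.add_apply, Pi.smul_apply, smul_eq_mul]
  push_cast
  rw [pow_succ]
  field_simp

theorem dist_realApprox_succ_le (x : Fin n.totient → ℝ) (j : ℕ) :
    dist (D.realApprox x j) (D.realApprox x (j + 1)) ≤ 1 * (1 / (D.base : ℝ)) ^ j := by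
  have base_pos : (0 : ℝ) < D.base := two_pos.trans_le D.two_le_base_real
  refine (dist_pi_le_iff (by positivity)).2 fun i => ?_
  have one_le (digit) : (1 : ℝ) ≤ D.scale digit i := by exact_mod_cast D.one_le_scale digit i
  have le_base (digit) : (D.scale digit i : ℝ) ≤ D.base := by exact_mod_cast D.scale_le digit i
  rw [realApprox_succ, dist_self_add_right, one_mul, one_div_pow,
    Real.norm_of_nonneg (div_nonneg (zero_le_one.trans (one_le _)) (by positivity)),
    div_le_div_iff₀ (by positivity) (by positivity), one_mul, pow_succ']
  gcongr
  exact le_base _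

theorem exists_tendsto_realApprox (x : Fin n.totient → ℝ) :
    ∃ r, Tendsto (D.realApprox x) atTop (𝓝 r) :=
  cauchySeq_tendsto_of_complete (cauchySeq_of_le_geometric _ _
    (D.one_div_base_le.trans_lt one_half_lt_one) (D.dist_realApprox_succ_le x))

/-- The scaling factor attached to the real vector `x`: the limit of the factors attached to its
truncations. -/
noncomputable def realFactor (x : Fin n.totient → ℝ) : Fin n.totient → ℝ :=
  (D.exists_tendsto_realApprox x).choose

theorem tendsto_realApprox (x : Fin n.totient → ℝ) :
    Tendsto (D.realApprox x) atTop (𝓝 (D.realFactor x)) :=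
  (D.exists_tendsto_realApprox x).choose_spec

theorem dist_realApprox_realFactor_le (x : Fin n.totient → ℝ) (j : ℕ) :
    dist (D.realApprox x j) (D.realFactor x) ≤ 2 / (D.base : ℝ) ^ j := by
  have := D.one_div_base_le
  refine (dist_le_of_le_geometric_of_tendsto _ _ (this.trans_lt one_half_lt_one)
    (D.dist_realApprox_succ_le x) (D.tendsto_realApprox x) j).trans ?_
  rw [one_mul, one_div_pow, div_le_iff₀ (by linarith), div_mul_eq_mul_div]
  gcongr
  linarith

theorem one_le_realFactor (x : Fin n.totient → ℝ) (i : Fin n.totient) :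
    1 ≤ D.realFactor x i := by
  refine ge_of_tendsto' (tendsto_pi_nhds.1 (D.tendsto_realApprox x) i) fun j => ?_
  have base_pos : (0 : ℝ) < D.base := two_pos.trans_le D.two_le_base_real
  rw [realApprox, one_le_div (by positivity)]
  exact_mod_cast D.pow_le_factor j _ i

/-- The points `x + realFactor x ⊗ u` with `x` in the unit cube. -/
def realPoints (u : Fin n.totient → ℤ) : Set (Fin n.totient → ℝ) :=
  (fun x => x + cycloMul n (D.realFactor x) fun i => (u i : ℝ)) '' Set.Icc 0 1

theorem intCast_add_cycloMul_factor_div (u : Fin n.totient → ℤ) (x : Fin n.totient → ℝ) (j : ℕ) :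
    (fun i => ((D.truncation x j + cycloMul n (D.factor (j + 1) (D.truncation x j)) u) i : ℝ) /
        (D.base : ℝ) ^ j) =
      (fun i => (D.truncation x j i : ℝ) / (D.base : ℝ) ^ j) +
        cycloMul n (D.realApprox x j) fun i => (u i : ℝ) := by
  have realApprox_eq : D.realApprox x j = ((D.base : ℝ) ^ j)⁻¹ •
      fun i => (D.factor (j + 1) (D.truncation x j) i : ℝ) := funext fun i => div_eq_inv_mul _ _
  have cycloMul_smul (a : ℝ) (r v : Fin n.totient → ℝ) :
      cycloMul n (a • r) v = a • cycloMul n r v := (cycloMulHom n ℝ).map_smul₂ a r v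
  funext i
  rw [realApprox_eq, cycloMul_smul, cycloMul_intCast, Pi.add_apply, Pi.add_apply, Pi.smul_apply,
    smul_eq_mul, Int.cast_add, add_div, ← div_eq_inv_mul]

theorem exists_mem_patternPoints_dist_le (u : Fin n.totient → ℤ) {y : Fin n.totient → ℝ}
    (hy : y ∈ D.realPoints u) (j : ℕ) :
    ∃ z ∈ patternPoints n (D.base ^ (j + 1)) (D.factor (j + 1)) u,
      dist y (fun i => (z i : ℝ) / (D.base : ℝ) ^ j) ≤
        (1 + 2 * cycloBound n * ‖fun i => (u i : ℝ)‖) / (D.base : ℝ) ^ j := by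
  obtain ⟨x, ⟨x_nonneg, x_le⟩, rfl⟩ := hy
  have two_le := D.two_le_base_real
  have pow_pos : (0 : ℝ) < (D.base : ℝ) ^ j := by positivity
  refine ⟨_, add_cycloMul_mem_patternPoints _ u (x := D.truncation x j)
    fun i => ⟨Int.floor_nonneg.2 (mul_nonneg pow_pos.le (x_nonneg i)), Int.floor_lt.2 ?_⟩, ?_⟩
  · have x_le_one : x i ≤ 1 := x_le i
    push_cast
    rw [pow_succ]
    gcongr
    linarith
  · rw [intCast_add_cycloMul_factor_div]
    calc dist _ _ ≤ dist x _ + dist (cycloMul n (D.realFactor x) _) _ := dist_add_add_le _ _ _ _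
      _ ≤ 1 / (D.base : ℝ) ^ j +
          cycloBound n * (2 / (D.base : ℝ) ^ j) * ‖fun i => (u i : ℝ)‖ := by
        gcongr
        · exact dist_floor_div_le pow_pos x
        · refine (dist_cycloMul_le n _ _ _).trans ?_
          gcongr
          rw [dist_comm]
          exact D.dist_realApprox_realFactor_le x j
      _ = (1 + 2 * cycloBound n * ‖fun i => (u i : ℝ)‖) / (D.base : ℝ) ^ j := by ring

theorem hasCoverings_realPoints (hs : 0 ≤ s) {u : Fin n.totient → ℤ} (hu : u ∈ U) :
    HasCoverings (D.realPoints u) s := by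
  classical
  have two_le := D.two_le_base_real
  refine HasCoverings.of_approximations (W := D.base) (C := (D.base : ℝ) ^ s)
    (κ := 1 + 2 * cycloBound n * ‖fun i => (u i : ℝ)‖) (by linarith)
    (le_add_of_nonneg_right (by positivity)) (by positivity) hs
    (fun j => (patternPoints n (D.base ^ (j + 1)) (D.factor (j + 1)) u).image
      fun z i => (z i : ℝ) / (D.base : ℝ) ^ j) (fun j => ?_) fun y hy j => ?_
  · refine (Nat.cast_le.2 Finset.card_image_le).trans
      ((D.card_patternPoints_factor_le hu (j + 1)).trans_eq ?_)
    rw [pow_succ', Real.mul_rpow (by positivity) (by positivity)]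
  · obtain ⟨z, hz, dist_le⟩ := D.exists_mem_patternPoints_dist_le u hy j
    exact ⟨_, Finset.mem_image_of_mem _ hz, dist_le⟩

theorem containsPattern_of_realPoints_subset (hn : 0 < n) {F : Set (Fin n.totient → ℝ)}
    (hF : ∀ u ∈ U, D.realPoints u ⊆ F) {x : Fin n.totient → ℝ} (hx : x ∈ Set.Icc 0 1) :
    ContainsPattern n U F x := by
  refine ⟨D.realFactor x, fun realFactor_eq_zero => ?_, fun u hu => hF u hu ⟨x, hx, rfl⟩⟩
  have one_le := D.one_le_realFactor x ⟨0, Nat.totient_pos.2 hn⟩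
  rw [realFactor_eq_zero, Pi.zero_apply] at one_le
  exact zero_lt_one.not_ge one_le

end DigitSystem

theorem DigitSystem.exists_isCompact_minkowskiDim_eq {n : ℕ} (hn : 0 < n)
    {U : Finset (Fin n.totient → ℤ)} {s : ℝ} (D : DigitSystem n U s) (hs : 0 < s)
    (s_le : s ≤ n.totient) :
    ∃ F : Set (Fin n.totient → ℝ), IsCompact F ∧
      (∀ x : Fin n.totient → ℝ, (∀ i, x i ∈ Set.Icc (0 : ℝ) 1) → ContainsPattern n U F x) ∧
      minkowskiDim F = s := by
  have d_pos : 0 < n.totient := Nat.totient_pos.2 hn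
  have d_pos' : (0 : ℝ) < n.totient := by exact_mod_cast d_pos
  set grid := multiscaleGrid n.totient (s / n.totient)
  have s_eq : n.totient * (s / n.totient) = s := mul_div_cancel₀ s d_pos'.ne'
  have grid_coverings : HasCoverings grid s :=
    s_eq ▸ hasCoverings_multiscaleGrid d_pos (by positivity) ((div_le_one d_pos').2 s_le)
  have grid_packings : HasPackings grid s :=
    s_eq ▸ hasPackings_multiscaleGrid n.totient (by positivity)
  have coverings : HasCoverings ((⋃ u ∈ U, D.realPoints u) ∪ grid) s :=
    (HasCoverings.biUnion U fun u hu => D.hasCoverings_realPoints hs.le hu).union grid_coverings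
  refine ⟨_, coverings.isCompact_closure, fun x hx => D.containsPattern_of_realPoints_subset hn
    (fun u hu => ?_) ⟨fun i => (hx i).1, fun i => (hx i).2⟩,
    minkowskiDim_eq coverings.closure
      (grid_packings.mono (Set.subset_union_right.trans subset_closure))⟩
  exact (Set.subset_biUnion_of_mem (u := D.realPoints) hu).trans
    (Set.subset_union_left.trans subset_closure)

/-! ### Existence of small sets with patterns -/

theorem eventually_pos_sub_div_log {d : ℕ} (hd : 0 < d) (c : ℝ) :
    ∀ᶠ k : ℕ in atTop, 0 < Real.log k ∧ 0 < d - c / Real.log k := by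
  have tendsto_log : Tendsto (fun k : ℕ => Real.log k) atTop atTop :=
    Real.tendsto_log_atTop.comp tendsto_natCast_atTop_atTop
  have d_pos : (0 : ℝ) < d := by exact_mod_cast hd
  filter_upwards [tendsto_log.eventually_gt_atTop 0,
    (tendsto_log.const_div_atTop c).eventually_lt_const d_pos] with k log_pos div_lt
  exact ⟨log_pos, sub_pos.2 div_lt⟩

theorem eventually_exists_finset {n : ℕ} (hn : 0 < n) :
    ∀ᶠ k : ℕ in atTop, ∀ U : Finset (Fin n.totient → ℤ), IsAdmissible k U →
      ∀ᶠ N : ℕ in atTop, ∃ B : Finset (Fin n.totient → ℤ),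
        (∀ x : Fin n.totient → ℤ, (∀ i, x i ∈ Finset.Icc (1 : ℤ) N) →
          ContainsPattern n U (B : Set (Fin n.totient → ℤ)) x) ∧
        (B.card : ℝ) < (N : ℝ) ^ ((n.totient : ℝ) - 1 / 80 / Real.log k) := by
  filter_upwards [eventually_nonempty_digitSystem hn,
    eventually_pos_sub_div_log (Nat.totient_pos.2 hn) (1 / 40)]
    with k digitSystem ⟨log_pos, s_pos⟩ U hU
  obtain ⟨D⟩ := digitSystem U hU
  exact D.eventually_exists_finset hn s_pos.le (by gcongr; norm_num)

theorem eventually_exists_isCompact {n : ℕ} (hn : 0 < n) :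
    ∀ᶠ k : ℕ in atTop, ∀ U : Finset (Fin n.totient → ℤ), IsAdmissible k U →
      ∃ F : Set (Fin n.totient → ℝ), IsCompact F ∧
        (∀ x : Fin n.totient → ℝ, (∀ i, x i ∈ Set.Icc (0 : ℝ) 1) → ContainsPattern n U F x) ∧
        minkowskiDim F = (((n.totient : ℝ) - 1 / 40 / Real.log k : ℝ) : EReal) := by
  filter_upwards [eventually_nonempty_digitSystem hn,
    eventually_pos_sub_div_log (Nat.totient_pos.2 hn) (1 / 40)]
    with k digitSystem ⟨log_pos, s_pos⟩ U hU
  obtain ⟨D⟩ := digitSystem U hU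
  exact D.exists_isCompact_minkowskiDim_eq hn s_pos (sub_le_self _ (by positivity))

theorem gPrime_le_card {k N : ℕ} (B S : Finset ℤ) (hS : S.card = N)
    (hB : ∀ x ∈ S, ContainsAP k (B : Set ℤ) x) : gPrime k N ≤ B.card :=
  Nat.sInf_le ⟨B, S, rfl, hS, hB⟩

theorem ContainsAP.mono {k l : ℕ} (hkl : k ≤ l) {B : Set ℤ} {x : ℤ} (h : ContainsAP l B x) :
    ContainsAP k B x := by
  obtain ⟨r, r_ne_zero, mem⟩ := h
  exact ⟨r, r_ne_zero, fun i hi => mem i (Finset.Icc_subset_Icc_right hkl hi)⟩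

theorem gPrime_mono {k l : ℕ} (hkl : k ≤ l) (N : ℕ) : gPrime k N ≤ gPrime l N := by
  obtain ⟨B, S, B_card, S_card, containsAP⟩ := gPrime_spec l N
  exact B_card ▸ gPrime_le_card B S S_card fun x hx => (containsAP x hx).mono hkl

instance subsingleton_fin_totient_two : Subsingleton (Fin (Nat.totient 2)) :=
  (finCongr Nat.totient_two).subsingleton

theorem cycloMul_two (r u : Fin (Nat.totient 2) → ℤ) : cycloMul 2 r u = r * u := by
  have isRoot : aeval (-1 : ℤ) (cyclotomic 2 ℤ) = 0 := by simp [cyclotomic_two]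
  have val_eq_zero (i : Fin (Nat.totient 2)) : (i : ℕ) = 0 :=
    Nat.lt_one_iff.1 (i.2.trans_eq Nat.totient_two)
  have := zetaCoord_cycloMul 2 (-1 : ℤ) isRoot r u
  funext l
  simpa only [zetaCoord, Fintype.sum_subsingleton _ l, val_eq_zero, pow_zero, mul_one,
    Algebra.algebraMap_self, RingHom.id_apply, Pi.mul_apply] using this

/-- The set `{1, …, k}` of coefficients of a progression, as a subset of `ℤ ^ φ(2) = ℤ`. -/
noncomputable def apCoefficients (k : ℕ) : Finset (Fin (Nat.totient 2) → ℤ) :=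
  (Finset.Icc (1 : ℤ) k).image fun i _ => i

theorem mem_apCoefficients {k : ℕ} {u : Fin (Nat.totient 2) → ℤ} :
    u ∈ apCoefficients k ↔ ∃ i ∈ Finset.Icc (1 : ℤ) k, (fun _ => i) = u :=
  Finset.mem_image

theorem isAdmissible_apCoefficients (k : ℕ) : IsAdmissible k (apCoefficients k) where
  card_le := Finset.card_image_le.trans (by simp)
  zero_notMem h := by
    obtain ⟨i, hi, i_eq⟩ := mem_apCoefficients.1 h
    have := (Finset.mem_Icc.1 hi).1.trans_eq (congrFun i_eq default)
    exact zero_lt_one.not_ge this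
  abs_le u hu l := by
    obtain ⟨i, hi, rfl⟩ := mem_apCoefficients.1 hu
    obtain ⟨one_le, i_le⟩ := Finset.mem_Icc.1 hi
    have nonneg : 0 ≤ i := zero_le_one.trans one_le
    exact (abs_of_nonneg nonneg).trans_le
      (i_le.trans (by exact_mod_cast Nat.le_self_pow (by omega) k))

theorem ContainsPattern.containsAP {k : ℕ} {B : Set (Fin (Nat.totient 2) → ℤ)} {x : ℤ}
    (h : ContainsPattern 2 (apCoefficients k) B fun _ => x) :
    ContainsAP k ((fun y => y default) '' B) x := by
  obtain ⟨r, r_ne_zero, mem⟩ := h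
  refine ⟨r default, fun r_eq => r_ne_zero ?_, fun i hi => ⟨_, mem (fun _ => i) ?_, ?_⟩⟩
  · funext l
    rw [Subsingleton.elim l default, r_eq, Pi.zero_apply]
  · obtain ⟨one_le, i_le⟩ := Finset.mem_Icc.1 hi
    exact mem_apCoefficients.2 ⟨i, Finset.mem_Icc.2 ⟨by omega, by omega⟩, rfl⟩
  · simp only [cycloMul_two, Pi.add_apply, Pi.mul_apply, Int.cast_id, mul_comm]

theorem eventually_gPrime_le : ∀ᶠ k : ℕ in atTop, ∀ᶠ N : ℕ in atTop,
    (gPrime k N : ℝ) ≤ (N : ℝ) ^ (1 - 1 / 80 / Real.log k) := by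
  classical
  filter_upwards [eventually_exists_finset two_pos] with k exists_finset
  filter_upwards [exists_finset _ (isAdmissible_apCoefficients k)] with N ⟨B, hB, B_card⟩
  simp only [Nat.totient_two, Nat.cast_one] at B_card
  have gPrime_le : gPrime k N ≤ (B.image fun y => y default).card := by
    refine gPrime_le_card _ (Finset.Icc 1 N) (by simp) fun x hx => ?_
    rw [Finset.coe_image]
    exact (hB (fun _ => x) fun _ => hx).containsAP
  exact (Nat.cast_le.2 (gPrime_le.trans Finset.card_image_le)).trans B_card.le

theorem exists_gPrime_le : ∃ c : ℝ, 0 < c ∧ ∀ k : ℕ, 2 ≤ k → ∀ᶠ N : ℕ in atTop,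
    (gPrime k N : ℝ) ≤ (N : ℝ) ^ (1 - c / Real.log k) := by
  obtain ⟨K, hK⟩ := eventually_atTop.1 eventually_gPrime_le
  set L := max K 2
  have log_two_pos : 0 < Real.log 2 := Real.log_pos one_lt_two
  have log_two_le (k : ℕ) (hk : 2 ≤ k) : Real.log 2 ≤ Real.log k :=
    Real.log_le_log two_pos (by exact_mod_cast hk)
  have log_two_le_log_L := log_two_le L (le_max_right K 2)
  have log_L_pos : 0 < Real.log L := log_two_pos.trans_le log_two_le_log_L
  refine ⟨1 / 80 * (Real.log 2 / Real.log L), by positivity, fun k hk => ?_⟩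
  have log_two_le_log_k := log_two_le k hk
  have log_k_pos : 0 < Real.log k := log_two_pos.trans_le log_two_le_log_k
  have div_le_div : 1 / 80 * (Real.log 2 / Real.log L) / Real.log k ≤
      1 / 80 / Real.log (max k L : ℕ) := by
    rcases le_total k L with h | h
    · rw [max_eq_right h, mul_div_assoc, div_eq_mul_one_div (1 / 80) (Real.log L), div_right_comm]
      gcongr
      exact (div_le_one log_k_pos).2 log_two_le_log_k
    · rw [max_eq_left h]
      gcongr
      exact mul_le_of_le_one_right (by norm_num) ((div_le_one log_L_pos).2 log_two_le_log_L)
  filter_upwards [hK (max k L) ((le_max_left K 2).trans (le_max_right k L)),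
    eventually_ge_atTop 1] with N gPrime_le one_le
  calc (gPrime k N : ℝ) ≤ gPrime (max k L) N := Nat.cast_le.2 (gPrime_mono (le_max_left k L) N)
    _ ≤ (N : ℝ) ^ (1 - 1 / 80 / Real.log (max k L : ℕ)) := gPrime_le
    _ ≤ (N : ℝ) ^ (1 - 1 / 80 * (Real.log 2 / Real.log L) / Real.log k) :=
      Real.rpow_le_rpow_of_exponent_le (by exact_mod_cast one_le) (sub_le_sub_left div_le_div 1)

theorem mainTheorem7_general :
    (∃ c : ℝ, 0 < c ∧ ∀ n : ℕ, 0 < n →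
      ∀ᶠ k : ℕ in atTop, ∀ U : Finset (Fin n.totient → ℤ), IsAdmissible k U →
        ∀ᶠ N : ℕ in atTop, ∃ B : Finset (Fin n.totient → ℤ),
          (∀ x : Fin n.totient → ℤ, (∀ i, x i ∈ Finset.Icc (1 : ℤ) N) →
            ContainsPattern n U (B : Set (Fin n.totient → ℤ)) x) ∧
          (B.card : ℝ) < (N : ℝ) ^ ((n.totient : ℝ) - c / Real.log k)) ∧
    (∃ c : ℝ, 0 < c ∧ ∀ n : ℕ, 0 < n →
      ∀ᶠ k : ℕ in atTop, ∀ U : Finset (Fin n.totient → ℤ), IsAdmissible k U →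
        ∃ F : Set (Fin n.totient → ℝ), IsCompact F ∧
          (∀ x : Fin n.totient → ℝ, (∀ i, x i ∈ Set.Icc (0 : ℝ) 1) → ContainsPattern n U F x) ∧
          minkowskiDim F = (((n.totient : ℝ) - c / Real.log k : ℝ) : EReal)) ∧
    (∃ c : ℝ, 0 < c ∧ ∀ k : ℕ, 2 ≤ k → ∀ᶠ N : ℕ in atTop,
      (gPrime k N : ℝ) ≤ (N : ℝ) ^ (1 - c / Real.log k)) :=
  ⟨⟨1 / 80, by norm_num, fun _ => eventually_exists_finset⟩,
    ⟨1 / 40, by norm_num, fun _ => eventually_exists_isCompact⟩, exists_gPrime_le⟩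

theorem eventually_isAdmissible {d : ℕ} (hd : 0 < d) {U : ℕ → Finset (Fin d → ℤ)}
    (card_le : ∀ k, (U k).card ≤ k) (ne_zero : ∀ k, ∀ u ∈ U k, ∀ i, u i ≠ 0)
    (abs_le : ∃ g : ℕ → ℝ, g =o[atTop] (fun k : ℕ => (k : ℝ)) ∧
      ∀ k, ∀ u ∈ U k, ∀ i, |(u i : ℝ)| ≤ (2 : ℝ) ^ g k) :
    ∀ᶠ k in atTop, IsAdmissible k (U k) := by
  obtain ⟨g, g_isLittleO, abs_le⟩ := abs_le
  filter_upwards [g_isLittleO.bound one_pos, eventually_ge_atTop 2] with k g_le two_le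
  refine ⟨card_le k, fun h => ne_zero k 0 h ⟨0, hd⟩ rfl, fun u hu i => ?_⟩
  have : |(u i : ℝ)| ≤ (k : ℝ) ^ k := calc
    |(u i : ℝ)| ≤ (2 : ℝ) ^ g k := abs_le k u hu i
    _ ≤ (2 : ℝ) ^ (k : ℝ) := by
      gcongr
      · exact one_le_two
      · simpa using (le_abs_self _).trans g_le
    _ ≤ (k : ℝ) ^ k := by
      rw [Real.rpow_natCast]
      gcongr
      exact_mod_cast two_le
  exact_mod_cast this

theorem pos_of_eq_two_or_four_or_prime_pow {n : ℕ} (hn : n = 2 ∨ n = 4 ∨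
    ∃ p m : ℕ, p.Prime ∧ p ≠ 2 ∧ 1 ≤ m ∧ (n = p ^ m ∨ n = 2 * p ^ m)) : 0 < n := by
  rcases hn with rfl | rfl | ⟨p, m, hp, -, -, rfl | rfl⟩
  · exact two_pos
  · exact four_pos
  · exact pow_pos hp.pos m
  · exact mul_pos two_pos (pow_pos hp.pos m)

theorem mainTheorem7 :
    -- discrete statement
    (∃ c : ℝ, 0 < c ∧
      ∀ n : ℕ,
        (n = 2 ∨ n = 4 ∨ ∃ p m : ℕ, p.Prime ∧ p ≠ 2 ∧ 1 ≤ m ∧ (n = p ^ m ∨ n = 2 * p ^ m)) →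
      ∀ U : ℕ → Finset (Fin n.totient → ℤ),
        (∀ k, (U k).card = k) →
        (∀ k, ∀ u ∈ U k, ∀ i, u i ≠ 0) →
        (∃ g : ℕ → ℝ, g =o[atTop] (fun k : ℕ => (k : ℝ)) ∧
          ∀ k, ∀ u ∈ U k, ∀ i, |(u i : ℝ)| ≤ (2 : ℝ) ^ g k) →
        ∀ᶠ k : ℕ in atTop, ∀ᶠ N : ℕ in atTop,
          ∃ B : Finset (Fin n.totient → ℤ),
            (∀ x : Fin n.totient → ℤ, (∀ i, x i ∈ Finset.Icc (1 : ℤ) N) →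
              ContainsPattern n (U k) (B : Set (Fin n.totient → ℤ)) x) ∧
            (B.card : ℝ) < (N : ℝ) ^ ((n.totient : ℝ) - c / Real.log k)) ∧
    -- continuous statement
    (∃ c : ℝ, 0 < c ∧
      ∀ n : ℕ,
        (n = 2 ∨ n = 4 ∨ ∃ p m : ℕ, p.Prime ∧ p ≠ 2 ∧ 1 ≤ m ∧ (n = p ^ m ∨ n = 2 * p ^ m)) →
      ∀ U : ℕ → Finset (Fin n.totient → ℤ),
        (∀ k, (U k).card = k) →
        (∀ k, ∀ u ∈ U k, ∀ i, u i ≠ 0) →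
        (∃ g : ℕ → ℝ, g =o[atTop] (fun k : ℕ => (k : ℝ)) ∧
          ∀ k, ∀ u ∈ U k, ∀ i, |(u i : ℝ)| ≤ (2 : ℝ) ^ g k) →
        ∀ᶠ k : ℕ in atTop,
          ∃ F : Set (Fin n.totient → ℝ), IsCompact F ∧
            (∀ x : Fin n.totient → ℝ, (∀ i, x i ∈ Set.Icc (0 : ℝ) 1) →
              ContainsPattern n (U k) F x) ∧
            minkowskiDim F = (((n.totient : ℝ) - c / Real.log k : ℝ) : EReal)) ∧
    -- arithmetic progressions
    (∃ c : ℝ, 0 < c ∧ ∀ k : ℕ, 2 ≤ k → ∀ᶠ N : ℕ in atTop,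
      (gPrime k N : ℝ) ≤ (N : ℝ) ^ (1 - c / Real.log k)) := by
  obtain ⟨⟨c, c_pos, discrete⟩, ⟨c', c'_pos, continuous⟩, progressions⟩ := mainTheorem7_general
  refine ⟨⟨c, c_pos, fun n hn U card ne_zero abs_le => ?_⟩,
    ⟨c', c'_pos, fun n hn U card ne_zero abs_le => ?_⟩, progressions⟩
  all_goals
    have n_pos := pos_of_eq_two_or_four_or_prime_pow hn
    have admissible := eventually_isAdmissible (Nat.totient_pos.2 n_pos) (fun k => (card k).le)
      ne_zero abs_le
  · filter_upwards [discrete n n_pos, admissible] with k exists_finset hU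
    exact exists_finset (U k) hU
  · filter_upwards [continuous n n_pos, admissible] with k exists_isCompact hU
    exact exists_isCompact (U k) hU
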